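/- For $m\ge 0$ let $[2m]=\{1,\dots,2m\}$. A matching on $[2m]$ is a partition of $[2m]$ into two-element blocks; a block $\{i,j\}$ with $i<j$ is called an arc $(i,j)$. A $k$-crossing of a matching is a set of $k$ arcs $(i_1,j_1),\dots,(i_k,j_k)$ with $i_1<i_2<\cdots<i_k<j_1<j_2<\cdots<j_k$, and a $k$-nesting is a set of $k$ arcs with $i_1<i_2<\cdots<i_k<j_k<\cdots<j_2<j_1$. A matching is $k$-noncrossing (respectively $k$-nonnesting) if it has no $k$-crossing (respectively no $k$-nesting). A matching on $[2m]$ is bilaterally symmetric if it is invariant under the reflection $x\mapsto 2m+1-x$, i.e. $(i,j)$ is an arc if and only if $(2m+1-j,2m+1-i)$ is an arc. Let $\mathrm{bsm}_m(3)$ be the number of bilaterally symmetric $4$-noncrossing matchings on $[2m]$. This is also the number of bilaterally symmetric $4$-nonnesting matchings on $[2m]$, and for every integer $n\ge 0$, $$\mathrm{bsm}_{2n}(3)=\sum_{s=0}^{n}\frac{2\,(2s+1)!}{s!^2\,(s+1)!\,(s+2)!}\cdot\frac{(2n)!}{(n-s)!\,(n-s+1)!},$$ $$\mathrm{bsm}_{2n+1}(3)=\sum_{s=0}^{n}\frac{2\,(2s+2)!}{s!\,(s+1)!\,(s+2)!^2}\cdot\frac{(2n+1)!}{(n-s)!\,(n-s+1)!}.$$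 -/

import Mathlib

/-- A partition of `[2n] = {1, …, 2n}` is a matching when each of its blocks has two elements. -/
def IsMatching {n : ℕ} (M : Finpartition (Finset.Icc 1 (2 * n))) : Prop :=
  ∀ B ∈ M.parts, B.card = 2

/-- `(i, j)` is an arc of `M`: `i < j` and `{i, j}` is a block of `M`. -/
def IsArc {n : ℕ} (M : Finpartition (Finset.Icc 1 (2 * n))) (i j : ℕ) : Prop :=
  i < j ∧ ({i, j} : Finset ℕ) ∈ M.parts

/-- `M` has a `k`-crossing: `k` arcs with `i₁ < i₂ < ⋯ < iₖ < j₁ < j₂ < ⋯ < jₖ`. -/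
def HasCrossing {n : ℕ} (M : Finpartition (Finset.Icc 1 (2 * n))) (k : ℕ) : Prop :=
  ∃ i j : Fin k → ℕ, (∀ r, IsArc M (i r) (j r)) ∧
    StrictMono i ∧ StrictMono j ∧ ∀ r s, i r < j s

/-- `M` has a `k`-nesting: `k` arcs with `i₁ < i₂ < ⋯ < iₖ < jₖ < ⋯ < j₂ < j₁`. -/
def HasNesting {n : ℕ} (M : Finpartition (Finset.Icc 1 (2 * n))) (k : ℕ) : Prop :=
  ∃ i j : Fin k → ℕ, (∀ r, IsArc M (i r) (j r)) ∧
    StrictMono i ∧ StrictAnti j ∧ ∀ r s, i r < j s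

/-- `M` is bilaterally symmetric: its set of blocks is unchanged by the reflection
`x ↦ 2n + 1 - x` of `[2n]`. -/
def IsBilaterallySymmetric {n : ℕ} (M : Finpartition (Finset.Icc 1 (2 * n))) : Prop :=
  M.parts.image (fun B => B.image (fun x => 2 * n + 1 - x)) = M.parts

open Classical in
/-- The number of bilaterally symmetric `(d+1)`-noncrossing matchings on `[2n]`. -/
noncomputable def bsmNoncrossing (n d : ℕ) : ℕ :=
  (Finset.univ.filter fun M : Finpartition (Finset.Icc 1 (2 * n)) =>
    IsMatching M ∧ IsBilaterallySymmetric M ∧ ¬ HasCrossing M (d + 1)).card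

open Classical in
/-- The number of bilaterally symmetric `(d+1)`-nonnesting matchings on `[2n]`. -/
noncomputable def bsmNonnesting (n d : ℕ) : ℕ :=
  (Finset.univ.filter fun M : Finpartition (Finset.Icc 1 (2 * n)) =>
    IsMatching M ∧ IsBilaterallySymmetric M ∧ ¬ HasNesting M (d + 1)).card

/-! A matching on [N], N = 2m, is a set of marked cells in a staircase triangle: the arc (i, j)
marks the cell (i − 1, N − j). Fomin's local rules grow partitions over this triangle from its empty
legs. Read along the hypotenuse they form a closed walk from ∅ to ∅ in which each step adds or
removes one box, and the marks can be recovered from the walk by running the rule backwards.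
Reflecting the matching transposes the triangle, so symmetric matchings correspond to palindromic
walks, hence to walks of length m from ∅ with free end (`card_symmetric_matchings_eq_card_walks`).

Crossings are descending chains of marks and nestings are ascending chains. Shapes with at most
three rows suffice exactly when there is no 4-crossing (`exists_isGrowth_rowLocalRule_iff`, by
Viennot's shadow lines). Shapes with at most three columns suffice exactly when there is no
4-nesting (`exists_isGrowth_columnLocalRule_iff`, by the longest ascent). Both families are thus
counted by the walks in the chamber x ≥ y ≥ z ≥ 0, which gives their equality.

After the shift by (3, 2, 1) these are walks in the strict chamber a > b > c > 0. Their exponential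
generating function is a Pfaffian in the Bessel-type series `lineEGF`
(`card_chamberWalks_eq_tripleEGF`): it obeys the walk recurrence, vanishes on the walls and has
constant term 1 inside. At the start (3, 2, 1) the sums telescope and the Pfaffian factors
(`tripleEGF_three_two_one`). One factor has the Catalan numbers as coefficients, the other a 2 × 2
determinant with product-form coefficients, and their binomial convolution is the stated sum. -/

/-! ### Walks on the line and their exponential generating functions. -/

/-- The number of walks on `ℤ` with `m` steps `±1` from `0` to `t`. -/
def lineWalks : ℕ → ℤ → ℕ
  | 0, t => if t = 0 then 1 else 0
  | m + 1, t => lineWalks m (t - 1) + lineWalks m (t + 1)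

theorem lineWalks_neg (m : ℕ) (t : ℤ) : lineWalks m (-t) = lineWalks m t := by
  induction m generalizing t with
  | zero => simp [lineWalks]
  | succ m ih =>
    rw [lineWalks, lineWalks, ← ih (t - 1), ← ih (t + 1), add_comm]
    congr 2 <;> ring

theorem lineWalks_eq_zero_of_lt (m : ℕ) (t : ℤ) (h : (m : ℤ) < t) : lineWalks m t = 0 := by
  induction m generalizing t with
  | zero =>
    have : t ≠ 0 := by push_cast at h; omega
    simp [lineWalks, this]
  | succ m ih =>
    push_cast at h
    rw [lineWalks, ih _ (by omega), ih _ (by omega)]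

theorem lineWalks_eq_choose (m k : ℕ) : lineWalks m (2 * k - m) = m.choose k := by
  induction m generalizing k with
  | zero => cases k <;> simp [lineWalks]; omega
  | succ m ih =>
    cases k with
    | zero =>
      have h := ih 0
      have e : (2 * ((0 : ℕ) : ℤ) - ((m + 1 : ℕ) : ℤ) + 1) = 2 * ((0 : ℕ) : ℤ) - m := by
        push_cast; ring
      rw [lineWalks, ← lineWalks_neg m (_ - 1),
        lineWalks_eq_zero_of_lt m (-_) (by push_cast; omega), e, h]
      simp
    | succ k =>
      rw [lineWalks, Nat.choose_succ_succ, ← ih k, ← ih (k + 1)]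
      congr 2 <;> push_cast <;> ring

theorem lineWalks_eq_zero_of_odd (m : ℕ) (t : ℤ) (h : (m + t) % 2 = 1) : lineWalks m t = 0 := by
  induction m generalizing t with
  | zero =>
    have : t ≠ 0 := by rintro rfl; simp at h
    simp [lineWalks, this]
  | succ m ih =>
    push_cast at h
    rw [lineWalks, ih _ (by omega), ih _ (by omega)]

open PowerSeries in
/-- The exponential generating function of the walks on `ℤ` from `0` to `t`. -/
noncomputable def lineEGF (t : ℤ) : PowerSeries ℚ :=
  PowerSeries.mk fun m => (lineWalks m t : ℚ) / (m.factorial : ℚ)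

theorem lineEGF_neg (t : ℤ) : lineEGF (-t) = lineEGF t := by
  simp [lineEGF, lineWalks_neg]

/-- `m!` times the coefficient of `X ^ m`. -/
noncomputable def egfCoeff (m : ℕ) (f : PowerSeries ℚ) : ℚ :=
  (m.factorial : ℚ) * PowerSeries.coeff m f

theorem egfCoeff_add (m : ℕ) (f g : PowerSeries ℚ) :
    egfCoeff m (f + g) = egfCoeff m f + egfCoeff m g := by
  simp [egfCoeff, mul_add]

theorem egfCoeff_sub (m : ℕ) (f g : PowerSeries ℚ) :
    egfCoeff m (f - g) = egfCoeff m f - egfCoeff m g := by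
  simp [egfCoeff, mul_sub]

theorem egfCoeff_succ (m : ℕ) (f : PowerSeries ℚ) :
    egfCoeff (m + 1) f = egfCoeff m (PowerSeries.derivative ℚ f) := by
  simp only [egfCoeff, PowerSeries.coeff_derivative, Nat.factorial_succ]
  push_cast
  ring

theorem egfCoeff_zero (f : PowerSeries ℚ) :
    egfCoeff 0 f = PowerSeries.constantCoeff f := by
  simp [egfCoeff]

theorem egfCoeff_lineEGF (m : ℕ) (t : ℤ) : egfCoeff m (lineEGF t) = lineWalks m t := by
  have : (m.factorial : ℚ) ≠ 0 := by exact_mod_cast m.factorial_ne_zero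
  simp only [egfCoeff, lineEGF, PowerSeries.coeff_mk]
  field_simp

theorem egfCoeff_mul (m : ℕ) (f g : PowerSeries ℚ) :
    egfCoeff m (f * g) =
      ∑ k ∈ Finset.range (m + 1), (m.choose k : ℚ) * (egfCoeff k f * egfCoeff (m - k) g) := by
  rw [egfCoeff, PowerSeries.coeff_mul, Finset.Nat.sum_antidiagonal_eq_sum_range_succ_mk,
    Finset.mul_sum]
  refine Finset.sum_congr rfl fun k hk => ?_
  have hk : k ≤ m := by simpa [Nat.lt_succ_iff] using hk
  rw [← Nat.choose_mul_factorial_mul_factorial hk, egfCoeff, egfCoeff]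
  push_cast
  ring

theorem derivative_lineEGF (t : ℤ) :
    PowerSeries.derivative ℚ (lineEGF t) = lineEGF (t - 1) + lineEGF (t + 1) := by
  ext m
  have h : (m.factorial : ℚ) ≠ 0 := by exact_mod_cast m.factorial_ne_zero
  have := egfCoeff_succ m (lineEGF t)
  rw [egfCoeff_lineEGF, lineWalks, Nat.cast_add, ← egfCoeff_lineEGF, ← egfCoeff_lineEGF,
    ← egfCoeff_add] at this
  exact (mul_left_cancel₀ h this).symm

/-- The product of the two series counts planar walks with `m` axis-parallel unit steps ending at
(s, t). The rotation (x, y) ↦ (x + y, x − y) turns such a walk into two independent ±1 walks of the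
same length. -/
theorem egfCoeff_lineEGF_mul (m : ℕ) (s t : ℤ) :
    egfCoeff m (lineEGF s * lineEGF t) = lineWalks m (s + t) * lineWalks m (s - t) := by
  induction m generalizing s t with
  | zero =>
    rw [egfCoeff_zero, map_mul, ← egfCoeff_zero, ← egfCoeff_zero, egfCoeff_lineEGF,
      egfCoeff_lineEGF]
    simp only [lineWalks]
    norm_cast
    split_ifs <;> first | rfl | omega
  | succ m ih =>
    rw [egfCoeff_succ, Derivation.leibniz, derivative_lineEGF, derivative_lineEGF]
    simp only [smul_eq_mul, mul_add, egfCoeff_add]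
    rw [mul_comm (lineEGF t), mul_comm (lineEGF t)]
    simp only [ih, lineWalks]
    push_cast
    rw [show s + (t - 1) = s + t - 1 by ring, show s - (t - 1) = s - t + 1 by ring,
      show s + (t + 1) = s + t + 1 by ring, show s - (t + 1) = s - t - 1 by ring,
      show s - 1 + t = s + t - 1 by ring, show s - 1 - t = s - t - 1 by ring,
      show s + 1 + t = s + t + 1 by ring, show s + 1 - t = s - t + 1 by ring]
    ring

theorem constantCoeff_lineEGF (t : ℤ) :
    PowerSeries.constantCoeff (lineEGF t) = if t = 0 then 1 else 0 := by
  rw [← egfCoeff_zero, egfCoeff_lineEGF]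
  simp [lineWalks]

theorem X_pow_dvd_lineEGF (m : ℕ) (t : ℤ) (h : (m : ℤ) ≤ t) :
    (PowerSeries.X : PowerSeries ℚ) ^ m ∣ lineEGF t := by
  rw [PowerSeries.X_pow_dvd_iff]
  intro k hk
  simp [lineEGF, lineWalks_eq_zero_of_lt k t (by omega)]

/-! ### The Pfaffian for three non-colliding positive walks with free ends. -/

/-- The tail sum over `x > μ` of the reflected generating functions of the walks on the half line
from `a` to `x`. -/
noncomputable def tailEGF (a : ℕ) (μ : ℤ) : PowerSeries ℚ :=
  ∑ i ∈ Finset.range a, (lineEGF (μ - i) + lineEGF (μ + 1 + i))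

/-- Differentiation strips the first step, so this is the walk recurrence in the starting point,
with `tailEGF 0 μ = 0` as absorbing wall. -/
theorem derivative_tailEGF (a : ℕ) (μ : ℤ) :
    PowerSeries.derivative ℚ (tailEGF (a + 1) μ) = tailEGF a μ + tailEGF (a + 2) μ := by
  induction a with
  | zero =>
    simp [tailEGF, Finset.sum_range_succ, derivative_lineEGF]
    ring_nf
  | succ a ih =>
    have h : ∀ k, tailEGF (k + 1) μ = tailEGF k μ + (lineEGF (μ - k) + lineEGF (μ + 1 + k)) :=
      fun k => Finset.sum_range_succ _ _
    rw [h (a + 1), map_add, ih, h (a + 2), h a]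
    simp only [map_add, derivative_lineEGF]
    push_cast
    ring_nf

theorem constantCoeff_tailEGF (a μ : ℕ) :
    PowerSeries.constantCoeff (tailEGF a μ) = if μ < a then 1 else 0 := by
  induction a with
  | zero => simp [tailEGF]
  | succ a ih =>
    rw [tailEGF, Finset.sum_range_succ, map_add, ← tailEGF, ih, map_add, constantCoeff_lineEGF,
      constantCoeff_lineEGF]
    split_ifs <;> first | omega | norm_num

/-- Truncation at height `L` of the generating function of the pairs of walks from `b > c` that
stay positive and distinct. -/
noncomputable def pairEGF (L b c : ℕ) : PowerSeries ℚ :=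
  ∑ μ ∈ Finset.range L,
    (tailEGF c (μ : ℤ) * tailEGF b (μ + 1 : ℤ) - tailEGF b (μ : ℤ) * tailEGF c (μ + 1 : ℤ))

theorem pairEGF_self (L b : ℕ) : pairEGF L b b = 0 := by
  simp [pairEGF]

theorem pairEGF_zero (L b : ℕ) : pairEGF L b 0 = 0 := by
  simp [pairEGF, tailEGF]

theorem derivative_pairEGF (L b c : ℕ) :
    PowerSeries.derivative ℚ (pairEGF L (b + 1) (c + 1)) =
      pairEGF L b (c + 1) + pairEGF L (b + 2) (c + 1) + pairEGF L (b + 1) c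
        + pairEGF L (b + 1) (c + 2) := by
  simp only [pairEGF, map_sum, ← Finset.sum_add_distrib, map_sub, Derivation.leibniz,
    derivative_tailEGF, smul_eq_mul]
  refine Finset.sum_congr rfl fun μ _ => ?_
  ring

theorem constantCoeff_pairEGF (L b c : ℕ) (hc : 0 < c) (hbc : c < b) (hL : c ≤ L) :
    PowerSeries.constantCoeff (pairEGF L b c) = 1 := by
  -- Only the summand μ = c − 1 has a nonzero constant term; the partial sums jump from 0 to 1
  -- there.
  have h : ∀ K : ℕ, PowerSeries.constantCoeff (pairEGF K b c) = 1 - if K < c then 1 else 0 := by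
    intro K
    induction K with
    | zero => simp [pairEGF, hc]
    | succ K ih =>
      rw [pairEGF, Finset.sum_range_succ, map_add, ← pairEGF, ih]
      have e : ((K : ℤ) + 1) = ((K + 1 : ℕ) : ℤ) := by push_cast; rfl
      rw [e, map_sub, map_mul, map_mul]
      simp only [constantCoeff_tailEGF]
      split_ifs <;> first | omega | norm_num
  rw [h, if_neg (by omega), sub_zero]

/-- Truncation at height `L` of the generating function of the triples of walks from
`a > b > c` that stay positive and distinct. -/
noncomputable def tripleEGF (L a b c : ℕ) : PowerSeries ℚ :=
  tailEGF a 0 * pairEGF L b c - tailEGF b 0 * pairEGF L a c + tailEGF c 0 * pairEGF L a b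

/-- The Pfaffian vanishes on the three walls that a step out of the strict chamber can reach. The
boundary values, the recurrence `derivative_tripleEGF` and the constant term 1 inside determine it.
-/
theorem tripleEGF_left (L a c : ℕ) : tripleEGF L a a c = 0 := by
  simp [tripleEGF, pairEGF_self]

theorem tripleEGF_right (L a c : ℕ) : tripleEGF L a c c = 0 := by
  simp [tripleEGF, pairEGF_self]

theorem tripleEGF_zero (L a b : ℕ) : tripleEGF L a b 0 = 0 := by
  simp [tripleEGF, pairEGF_zero, tailEGF]

theorem derivative_tripleEGF (L a b c : ℕ) :
    PowerSeries.derivative ℚ (tripleEGF L (a + 1) (b + 1) (c + 1)) =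
      tripleEGF L a (b + 1) (c + 1) + tripleEGF L (a + 2) (b + 1) (c + 1)
        + (tripleEGF L (a + 1) b (c + 1) + tripleEGF L (a + 1) (b + 2) (c + 1))
        + (tripleEGF L (a + 1) (b + 1) c + tripleEGF L (a + 1) (b + 1) (c + 2)) := by
  simp only [tripleEGF, map_add, map_sub, Derivation.leibniz, derivative_tailEGF,
    derivative_pairEGF, smul_eq_mul]
  ring

theorem constantCoeff_tripleEGF (L a b c : ℕ) (hc : 0 < c) (hbc : c < b) (hab : b < a)
    (hL : b ≤ L) : PowerSeries.constantCoeff (tripleEGF L a b c) = 1 := by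
  have h := fun k => constantCoeff_tailEGF k 0
  simp only [Nat.cast_zero] at h
  simp only [tripleEGF, map_add, map_sub, map_mul, h]
  rw [constantCoeff_pairEGF L b c hc hbc (by omega),
    constantCoeff_pairEGF L a c hc (by omega) (by omega),
    constantCoeff_pairEGF L a b (by omega) (by omega) (by omega)]
  rw [if_pos (by omega), if_pos (by omega), if_pos (by omega)]
  norm_num

/-! ### Telescoping and factorization of the Pfaffian. -/

/-- The shift-difference potential of the sums `pairEGF`. -/
noncomputable def pairPotential (i d : ℕ) (t : ℤ) : PowerSeries ℚ :=
  ∑ r ∈ Finset.range (1 + i + (i + d)),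
      (lineEGF (t + r - (i + d)) * lineEGF (t + r + 1 - i)
        - lineEGF (t + r - i) * lineEGF (t + r + 1 - (i + d)))
    + ∑ r ∈ Finset.range d,
      (lineEGF (t + r - (i + d)) * lineEGF (t + r + 2 + i)
        - lineEGF (t + r + 1 + i) * lineEGF (t + r + 1 - (i + d)))

theorem sum_range_shift {R : Type*} [AddCommGroup R] (A : ℤ → R) (n : ℕ) (t : ℤ) :
    ∑ r ∈ Finset.range n, A (t + 1 + r) = ∑ r ∈ Finset.range n, A (t + r) + A (t + n) - A t := by
  have h1 := Finset.sum_range_succ (fun r : ℕ => A (t + r)) n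
  have h2 := Finset.sum_range_succ' (fun r : ℕ => A (t + r)) n
  rw [h1] at h2
  rw [h2]
  simp only [Nat.cast_zero, add_zero, add_sub_cancel_right]
  refine Finset.sum_congr rfl fun r _ => ?_
  push_cast
  congr 1
  ring

/-- The right side expands into four differences of products. They form two couples, and in each
couple one difference is minus a translate of the other, by 1 + i + (i + d) or by d. A translation
by n telescopes over n unit shifts, hence the two ranges in `pairPotential`. -/
theorem pairPotential_succ (i d : ℕ) (t : ℤ) :
    pairPotential i d (t + 1) - pairPotential i d t =
      (lineEGF (t - i) + lineEGF (t + 1 + i))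
          * (lineEGF (t + 1 - (i + d)) + lineEGF (t + 1 + 1 + (i + d)))
        - (lineEGF (t - (i + d)) + lineEGF (t + 1 + (i + d)))
          * (lineEGF (t + 1 - i) + lineEGF (t + 1 + 1 + i)) := by
  have h1 := sum_range_shift (fun u => lineEGF (u - (i + d)) * lineEGF (u + 1 - i)
    - lineEGF (u - i) * lineEGF (u + 1 - (i + d))) (1 + i + (i + d)) t
  have h2 := sum_range_shift (fun u => lineEGF (u - (i + d)) * lineEGF (u + 2 + i)
    - lineEGF (u + 1 + i) * lineEGF (u + 1 - (i + d))) d t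
  rw [pairPotential, pairPotential, h1, h2]
  generalize ∑ r ∈ Finset.range (1 + i + (i + d)), (_ : PowerSeries ℚ) = S
  generalize ∑ r ∈ Finset.range d, (_ : PowerSeries ℚ) = S'
  push_cast
  ring_nf

theorem sum_pair_eq (i d L : ℕ) :
    ∑ μ ∈ Finset.range L, ((lineEGF (μ - i) + lineEGF (μ + 1 + i))
          * (lineEGF (μ + 1 - (i + d)) + lineEGF (μ + 1 + 1 + (i + d)))
        - (lineEGF (μ - (i + d)) + lineEGF (μ + 1 + (i + d)))
          * (lineEGF (μ + 1 - i) + lineEGF (μ + 1 + 1 + i))) =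
      pairPotential i d L - pairPotential i d 0 := by
  rw [Finset.sum_congr rfl fun (μ : ℕ) _ => (pairPotential_succ i d μ).symm]
  have := Finset.sum_range_sub (fun μ : ℕ => pairPotential i d μ) L
  simpa using this

theorem X_pow_dvd_pairPotential (m i d : ℕ) (t : ℤ) (h : (m : ℤ) + i + d ≤ t) :
    (PowerSeries.X : PowerSeries ℚ) ^ m ∣ pairPotential i d t := by
  refine dvd_add (Finset.dvd_sum fun r _ => dvd_sub ?_ ?_)
    (Finset.dvd_sum fun r _ => dvd_sub ?_ ?_) <;>
  exact Dvd.dvd.mul_right (X_pow_dvd_lineEGF m _ (by omega)) _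

/-- The start (3, 2, 1) is the empty partition after the shift. The potentials at 0 give a
polynomial in `lineEGF 0`, …, `lineEGF 3` that factors; the potentials at `L` are a remainder of
high order in X. -/
theorem tripleEGF_three_two_one (L : ℕ) :
    tripleEGF L 3 2 1 =
      (lineEGF 0 - lineEGF 2) * ((lineEGF 0 + lineEGF 1) * (lineEGF 0 + lineEGF 3)
          - (lineEGF 1 + lineEGF 2) ^ 2)
        + ((lineEGF 2 + lineEGF 3) * pairPotential 0 1 L
          - (lineEGF 1 + lineEGF 2) * pairPotential 0 2 L
          + (lineEGF 0 + lineEGF 1) * pairPotential 1 1 L) := by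
  have h01 := sum_pair_eq 0 1 L
  have h02 := sum_pair_eq 0 2 L
  have h12 := sum_pair_eq 1 1 L
  -- `pairEGF` is bilinear and alternating in the summands of `tailEGF`, so only the pairs of
  -- distinct summands survive here and in `e2`, `e3`.
  have e1 : pairEGF L 2 1 = pairPotential 0 1 L - pairPotential 0 1 0 := by
    rw [← h01, pairEGF]
    refine Finset.sum_congr rfl fun μ _ => ?_
    simp only [tailEGF, Finset.sum_range_succ, Finset.sum_range_zero]
    push_cast
    ring_nf
  have e2 : pairEGF L 3 1 = (pairPotential 0 1 L - pairPotential 0 1 0)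
      + (pairPotential 0 2 L - pairPotential 0 2 0) := by
    rw [← h01, ← h02, pairEGF, ← Finset.sum_add_distrib]
    refine Finset.sum_congr rfl fun μ _ => ?_
    simp only [tailEGF, Finset.sum_range_succ, Finset.sum_range_zero]
    push_cast
    ring_nf
  have e3 : pairEGF L 3 2 = (pairPotential 0 2 L - pairPotential 0 2 0)
      + (pairPotential 1 1 L - pairPotential 1 1 0) := by
    rw [← h02, ← h12, pairEGF, ← Finset.sum_add_distrib]
    refine Finset.sum_congr rfl fun μ _ => ?_
    simp only [tailEGF, Finset.sum_range_succ, Finset.sum_range_zero]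
    push_cast
    ring_nf
  have n1 : lineEGF (-1) = lineEGF 1 := lineEGF_neg 1
  have n2 : lineEGF (-2) = lineEGF 2 := lineEGF_neg 2
  have p1 : pairPotential 0 1 0 = -((lineEGF 0 + lineEGF 1) * (lineEGF 0 - lineEGF 2)) := by
    simp [pairPotential, Finset.sum_range_succ, n1]
    ring
  have p2 : pairPotential 0 2 0 = (lineEGF 2 * lineEGF 1 + lineEGF 1 * lineEGF 2
      + lineEGF 0 * lineEGF 3) - (lineEGF 0 * lineEGF 1 + lineEGF 1 * lineEGF 0
      + lineEGF 2 * lineEGF 1) + (lineEGF 2 * lineEGF 2 + lineEGF 1 * lineEGF 3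
      - lineEGF 1 * lineEGF 1 - lineEGF 2 * lineEGF 0) := by
    simp [pairPotential, Finset.sum_range_succ, n1, n2]
    ring
  have p3 : pairPotential 1 1 0 = (lineEGF 2 * lineEGF 0 + lineEGF 1 * lineEGF 1
      + lineEGF 0 * lineEGF 2 + lineEGF 1 * lineEGF 3) - (lineEGF 1 * lineEGF 1
      + lineEGF 0 * lineEGF 0 + lineEGF 1 * lineEGF 1 + lineEGF 2 * lineEGF 2)
      + (lineEGF 2 * lineEGF 3 - lineEGF 2 * lineEGF 1) := by
    simp [pairPotential, Finset.sum_range_succ, n1, n2]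
  rw [tripleEGF, e1, e2, e3, p1, p2, p3]
  simp only [tailEGF, Finset.sum_range_succ, Finset.sum_range_zero]
  norm_num [n1, n2]
  ring

theorem egfCoeff_tripleEGF_three_two_one (m L : ℕ) (h : m + 3 ≤ L) :
    egfCoeff m (tripleEGF L 3 2 1) = egfCoeff m ((lineEGF 0 - lineEGF 2)
      * ((lineEGF 0 + lineEGF 1) * (lineEGF 0 + lineEGF 3) - (lineEGF 1 + lineEGF 2) ^ 2)) := by
  rw [tripleEGF_three_two_one, egfCoeff_add]
  -- The potentials involved have i + d ≤ 2, so `L ≥ m + 3` pushes them past degree m.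
  have hd : ∀ i d : ℕ, i + d ≤ 2 → (PowerSeries.X : PowerSeries ℚ) ^ (m + 1) ∣
      pairPotential i d L := fun i d hid => X_pow_dvd_pairPotential _ i d _ (by push_cast; omega)
  have h0 : (PowerSeries.X : PowerSeries ℚ) ^ (m + 1) ∣
      ((lineEGF 2 + lineEGF 3) * pairPotential 0 1 L
          - (lineEGF 1 + lineEGF 2) * pairPotential 0 2 L
          + (lineEGF 0 + lineEGF 1) * pairPotential 1 1 L) :=
    dvd_add (dvd_sub (Dvd.dvd.mul_left (hd 0 1 (by norm_num)) _)
      (Dvd.dvd.mul_left (hd 0 2 le_rfl) _)) (Dvd.dvd.mul_left (hd 1 1 le_rfl) _)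
  rw [PowerSeries.X_pow_dvd_iff] at h0
  have h1 : egfCoeff m ((lineEGF 2 + lineEGF 3) * pairPotential 0 1 L
          - (lineEGF 1 + lineEGF 2) * pairPotential 0 2 L
          + (lineEGF 0 + lineEGF 1) * pairPotential 1 1 L) = 0 := by
    rw [egfCoeff, h0 m (Nat.lt_succ_self m), mul_zero]
  rw [h1, add_zero]

/-! ### Coefficients of the two factors and of their product. -/

theorem lineWalks_even (s t : ℕ) : lineWalks (2 * s) (2 * t) = (2 * s).choose (s + t) := by
  rw [← lineWalks_eq_choose]
  congr 1
  push_cast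
  ring

theorem lineWalks_odd (s t : ℕ) :
    lineWalks (2 * s + 1) (2 * t + 1) = (2 * s + 1).choose (s + t + 1) := by
  rw [← lineWalks_eq_choose]
  congr 1
  push_cast
  ring

theorem cast_choose_succ_mul (n k : ℕ) :
    (n.choose (k + 1) : ℚ) * (k + 1) = n.choose k * ((n : ℚ) - k) := by
  rcases le_or_gt k n with h | h
  · have := Nat.choose_succ_right_eq n k
    rw [← Nat.cast_sub h]
    exact_mod_cast this
  · rw [Nat.choose_eq_zero_of_lt h, Nat.choose_eq_zero_of_lt (by omega)]
    simp

theorem cast_choose_two_mul (s : ℕ) :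
    ((2 * s).choose s : ℚ) = (2 * s).factorial / ((s.factorial : ℚ) * s.factorial) := by
  rw [Nat.cast_choose ℚ (show s ≤ 2 * s by omega), show 2 * s - s = s by omega]

/-- By reflection this difference counts the excursions of length 2s on the half line: the Catalan
number. -/
theorem egfCoeff_excursions_even (s : ℕ) :
    egfCoeff (2 * s) (lineEGF 0 - lineEGF 2) =
      (Nat.factorial (2 * s) : ℚ) / ((Nat.factorial s : ℚ) * Nat.factorial (s + 1)) := by
  have h0 := lineWalks_even s 0
  have h1 := lineWalks_even s 1
  have c1 := cast_choose_succ_mul (2 * s) s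
  have hs : (s.factorial : ℚ) ≠ 0 := by exact_mod_cast s.factorial_ne_zero
  have hs1 : (s : ℚ) + 1 ≠ 0 := by positivity
  simp only [Nat.cast_zero, Nat.cast_one, mul_zero, mul_one, add_zero] at h0 h1
  rw [egfCoeff_sub, egfCoeff_lineEGF, egfCoeff_lineEGF, h0, h1, eq_div_of_mul_eq hs1 c1,
    cast_choose_two_mul, Nat.factorial_succ]
  push_cast
  field_simp
  ring

theorem egfCoeff_excursions_odd (s : ℕ) :
    egfCoeff (2 * s + 1) (lineEGF 0 - lineEGF 2) = 0 := by
  rw [egfCoeff_sub, egfCoeff_lineEGF, egfCoeff_lineEGF,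
    lineWalks_eq_zero_of_odd _ _ (by push_cast; omega),
    lineWalks_eq_zero_of_odd _ _ (by push_cast; omega)]
  simp

/-- By `egfCoeff_lineEGF_mul` the coefficient is quadratic in walk counts. With w_t for `lineWalks m
t`, parity leaves (w₀ − w₂)(w₀ − w₄) for even m and (w₁ − w₃)² for odd m, which explains the product
formulas below. -/
theorem egfCoeff_det (m : ℕ) :
    egfCoeff m ((lineEGF 0 + lineEGF 1) * (lineEGF 0 + lineEGF 3) - (lineEGF 1 + lineEGF 2) ^ 2) =
      ((lineWalks m 0 : ℚ) ^ 2 + (lineWalks m 3 : ℚ) ^ 2 + (lineWalks m 1 : ℚ) ^ 2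
        + (lineWalks m 4 : ℚ) * lineWalks m 2) - ((lineWalks m 2 : ℚ) * lineWalks m 0
        + 2 * ((lineWalks m 3 : ℚ) * lineWalks m 1) + (lineWalks m 4 : ℚ) * lineWalks m 0) := by
  have e : (lineEGF 0 + lineEGF 1) * (lineEGF 0 + lineEGF 3) - (lineEGF 1 + lineEGF 2) ^ 2 =
      (lineEGF 0 * lineEGF 0 + lineEGF 3 * lineEGF 0 + lineEGF 1 * lineEGF 0
        + lineEGF 3 * lineEGF 1) - (lineEGF 1 * lineEGF 1
        + (lineEGF 2 * lineEGF 1 + lineEGF 2 * lineEGF 1) + lineEGF 2 * lineEGF 2) := by ring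
  rw [e]
  simp only [egfCoeff_sub, egfCoeff_add, egfCoeff_lineEGF_mul]
  norm_num
  ring

theorem egfCoeff_det_even (s : ℕ) :
    egfCoeff (2 * s) ((lineEGF 0 + lineEGF 1) * (lineEGF 0 + lineEGF 3)
        - (lineEGF 1 + lineEGF 2) ^ 2) =
      (2 * (Nat.factorial (2 * s + 1) : ℚ)) * Nat.factorial (2 * s) /
              ((Nat.factorial s : ℚ) ^ 2 * (Nat.factorial (s + 1) : ℚ) *
                (Nat.factorial (s + 2) : ℚ)) := by
  have h0 := lineWalks_even s 0
  have h1 := lineWalks_even s 1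
  have h2 := lineWalks_even s 2
  have c1 := cast_choose_succ_mul (2 * s) s
  have c2 := cast_choose_succ_mul (2 * s) (s + 1)
  have hs : (s.factorial : ℚ) ≠ 0 := by exact_mod_cast s.factorial_ne_zero
  have hs1 : (s : ℚ) + 1 ≠ 0 := by positivity
  have hs2 : (s : ℚ) + 1 + 1 ≠ 0 := by positivity
  norm_num at h0 h1 h2
  push_cast at c2
  rw [egfCoeff_det, h0, h1, h2, lineWalks_eq_zero_of_odd _ 1 (by push_cast; omega),
    lineWalks_eq_zero_of_odd _ 3 (by push_cast; omega), eq_div_of_mul_eq hs2 c2,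
    eq_div_of_mul_eq hs1 c1, cast_choose_two_mul, Nat.factorial_succ, Nat.factorial_succ (s + 1),
    Nat.factorial_succ s]
  push_cast
  field_simp
  ring

theorem egfCoeff_det_odd (s : ℕ) :
    egfCoeff (2 * s + 1) ((lineEGF 0 + lineEGF 1) * (lineEGF 0 + lineEGF 3)
        - (lineEGF 1 + lineEGF 2) ^ 2) =
      (2 * (Nat.factorial (2 * s + 2) : ℚ)) * Nat.factorial (2 * s + 1) /
              ((Nat.factorial s : ℚ) * (Nat.factorial (s + 1) : ℚ) *
                (Nat.factorial (s + 2) : ℚ) ^ 2) := by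
  have h1 := lineWalks_odd s 0
  have h3 := lineWalks_odd s 1
  have c2 := cast_choose_succ_mul (2 * s + 1) (s + 1)
  have c1 : ((2 * s + 1).choose (s + 1) : ℚ) =
      (2 * s + 1).factorial / (((s + 1).factorial : ℚ) * s.factorial) := by
    rw [Nat.cast_choose ℚ (show s + 1 ≤ 2 * s + 1 by omega),
      show 2 * s + 1 - (s + 1) = s by omega]
  have hs : (s.factorial : ℚ) ≠ 0 := by exact_mod_cast s.factorial_ne_zero
  have hs1 : (s : ℚ) + 1 ≠ 0 := by positivity
  have hs2 : (s : ℚ) + 1 + 1 ≠ 0 := by positivity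
  norm_num at h1 h3
  push_cast at c2
  rw [egfCoeff_det, h1, h3, lineWalks_eq_zero_of_odd _ 0 (by push_cast; omega),
    lineWalks_eq_zero_of_odd _ 2 (by push_cast; omega),
    lineWalks_eq_zero_of_odd _ 4 (by push_cast; omega), eq_div_of_mul_eq hs2 c2, c1,
    Nat.factorial_succ (2 * s + 1), Nat.factorial_succ (s + 1), Nat.factorial_succ s]
  push_cast
  field_simp
  ring

theorem sum_range_even_odd {R : Type*} [AddCommMonoid R] (f : ℕ → R) (n : ℕ) :
    ∑ k ∈ Finset.range (2 * n), f k =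
      ∑ s ∈ Finset.range n, f (2 * s) + ∑ s ∈ Finset.range n, f (2 * s + 1) := by
  induction n with
  | zero => simp
  | succ n ih =>
    rw [show 2 * (n + 1) = 2 * n + 1 + 1 by ring, Finset.sum_range_succ, Finset.sum_range_succ, ih,
      Finset.sum_range_succ, Finset.sum_range_succ]
    abel

/-- Excursions have even length, so only even indices survive in the binomial convolution; each
binomial coefficient cancels the factorials (2s)! and (2n − 2s)! of the factors. -/
theorem egfCoeff_product_even (n : ℕ) :
    egfCoeff (2 * n) ((lineEGF 0 - lineEGF 2) * ((lineEGF 0 + lineEGF 1) * (lineEGF 0 + lineEGF 3)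
        - (lineEGF 1 + lineEGF 2) ^ 2)) =
      ∑ s ∈ Finset.range (n + 1),
          (2 * (Nat.factorial (2 * s + 1) : ℚ)) /
              ((Nat.factorial s : ℚ) ^ 2 * (Nat.factorial (s + 1) : ℚ) *
                (Nat.factorial (s + 2) : ℚ)) *
            ((Nat.factorial (2 * n) : ℚ) /
              ((Nat.factorial (n - s) : ℚ) * (Nat.factorial (n - s + 1) : ℚ))) := by
  rw [mul_comm (lineEGF 0 - lineEGF 2), egfCoeff_mul, Finset.sum_range_succ,
    sum_range_even_odd, Finset.sum_range_succ]
  have hz : ∑ s ∈ Finset.range n, ((2 * n).choose (2 * s + 1) : ℚ) *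
      (egfCoeff (2 * s + 1) ((lineEGF 0 + lineEGF 1) * (lineEGF 0 + lineEGF 3)
        - (lineEGF 1 + lineEGF 2) ^ 2) *
        egfCoeff (2 * n - (2 * s + 1)) (lineEGF 0 - lineEGF 2)) = 0 := by
    refine Finset.sum_eq_zero fun s hs => ?_
    have hs : s < n := by simpa using hs
    rw [show 2 * n - (2 * s + 1) = 2 * (n - s - 1) + 1 by omega, egfCoeff_excursions_odd]
    ring
  have ht : ∀ s ≤ n, ((2 * n).choose (2 * s) : ℚ) *
      (egfCoeff (2 * s) ((lineEGF 0 + lineEGF 1) * (lineEGF 0 + lineEGF 3)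
        - (lineEGF 1 + lineEGF 2) ^ 2) *
        egfCoeff (2 * n - 2 * s) (lineEGF 0 - lineEGF 2)) =
      (2 * (Nat.factorial (2 * s + 1) : ℚ)) /
              ((Nat.factorial s : ℚ) ^ 2 * (Nat.factorial (s + 1) : ℚ) *
                (Nat.factorial (s + 2) : ℚ)) *
            ((Nat.factorial (2 * n) : ℚ) /
              ((Nat.factorial (n - s) : ℚ) * (Nat.factorial (n - s + 1) : ℚ))) := by
    intro s hs
    rw [← Nat.choose_mul_factorial_mul_factorial (show 2 * s ≤ 2 * n by omega),
      show 2 * n - 2 * s = 2 * (n - s) by omega, egfCoeff_excursions_even, egfCoeff_det_even]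
    push_cast
    ring
  rw [hz, add_zero, ht n le_rfl]
  refine congrArg₂ _ (Finset.sum_congr rfl fun s hs => ht s ?_) rfl
  exact (Finset.mem_range.1 hs).le

theorem egfCoeff_product_odd (n : ℕ) :
    egfCoeff (2 * n + 1) ((lineEGF 0 - lineEGF 2)
      * ((lineEGF 0 + lineEGF 1) * (lineEGF 0 + lineEGF 3) - (lineEGF 1 + lineEGF 2) ^ 2)) =
      ∑ s ∈ Finset.range (n + 1),
          (2 * (Nat.factorial (2 * s + 2) : ℚ)) /
              ((Nat.factorial s : ℚ) * (Nat.factorial (s + 1) : ℚ) *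
                (Nat.factorial (s + 2) : ℚ) ^ 2) *
            ((Nat.factorial (2 * n + 1) : ℚ) /
              ((Nat.factorial (n - s) : ℚ) * (Nat.factorial (n - s + 1) : ℚ))) := by
  rw [mul_comm (lineEGF 0 - lineEGF 2), egfCoeff_mul, show 2 * n + 1 + 1 = 2 * (n + 1) by ring,
    sum_range_even_odd]
  have hz : ∑ s ∈ Finset.range (n + 1), ((2 * n + 1).choose (2 * s) : ℚ) *
      (egfCoeff (2 * s) ((lineEGF 0 + lineEGF 1) * (lineEGF 0 + lineEGF 3)
        - (lineEGF 1 + lineEGF 2) ^ 2) *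
        egfCoeff (2 * n + 1 - 2 * s) (lineEGF 0 - lineEGF 2)) = 0 := by
    refine Finset.sum_eq_zero fun s hs => ?_
    have hs : s < n + 1 := by simpa using hs
    rw [show 2 * n + 1 - 2 * s = 2 * (n - s) + 1 by omega, egfCoeff_excursions_odd]
    ring
  rw [hz, zero_add]
  refine Finset.sum_congr rfl fun s hs => ?_
  have hs : s < n + 1 := by simpa using hs
  rw [← Nat.choose_mul_factorial_mul_factorial (show 2 * s + 1 ≤ 2 * n + 1 by omega),
    show 2 * n + 1 - (2 * s + 1) = 2 * (n - s) by omega, egfCoeff_excursions_even,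
    egfCoeff_det_odd]
  push_cast
  ring

/-! ### Walks in the chamber of partitions. -/

/-- The points of `ℤ³` as row lengths (or column lengths) of Young diagrams. -/
abbrev Shape : Type := ℤ × ℤ × ℤ

/-- The closed Weyl chamber of partitions with at most three parts. -/
def Shape.IsPartition (v : Shape) : Prop :=
  0 ≤ v.2.2 ∧ v.2.2 ≤ v.2.1 ∧ v.2.1 ≤ v.1

instance : DecidablePred Shape.IsPartition := fun v => by
  unfold Shape.IsPartition; infer_instance

/-- The number of boxes of a shape. -/
def Shape.size (v : Shape) : ℤ := v.1 + v.2.1 + v.2.2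

/-- `v` is a partition that arises from the partition `u` by adding at most one box. -/
def Shape.Step (u v : Shape) : Prop :=
  u.IsPartition ∧ v.IsPartition ∧ u.1 ≤ v.1 ∧ u.2.1 ≤ v.2.1 ∧ u.2.2 ≤ v.2.2 ∧
    v.1 + v.2.1 + v.2.2 ≤ u.1 + u.2.1 + u.2.2 + 1

/-- One of the partitions `u`, `v` arises from the other one by adding one box. -/
def Shape.Adj (u v : Shape) : Prop :=
  (u.Step v ∨ v.Step u) ∧ u.size ≠ v.size

theorem Shape.Adj.symm {u v : Shape} (h : u.Adj v) : v.Adj u :=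
  ⟨h.1.symm, h.2.symm⟩

/-- The six unit steps in `ℤ³`. -/
def unitSteps : Finset Shape :=
  {(1, 0, 0), (-1, 0, 0), (0, 1, 0), (0, -1, 0), (0, 0, 1), (0, 0, -1)}

/-- The partitions that differ from `v` by one box. -/
def Shape.neighbors (v : Shape) : Finset Shape :=
  (unitSteps.image (v + ·)).filter Shape.IsPartition

theorem Shape.mem_neighbors {u v : Shape} (hv : v.IsPartition) :
    u ∈ v.neighbors ↔ v.Adj u := by
  obtain ⟨a, b, c⟩ := v
  obtain ⟨x, y, z⟩ := u
  simp only [neighbors, unitSteps, Finset.mem_filter, Finset.mem_image, Finset.mem_insert,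
    Finset.mem_singleton, exists_eq_or_imp, exists_eq_left, Prod.mk_add_mk, Prod.mk.injEq, Adj,
    Step, size, IsPartition] at *
  omega

theorem Shape.sum_neighbors {R : Type*} [AddCommMonoid R] (f : Shape → R) (v : Shape) :
    ∑ u ∈ v.neighbors, f u = ∑ d ∈ unitSteps, if (v + d).IsPartition then f (v + d) else 0 := by
  rw [neighbors, Finset.sum_filter, Finset.sum_image]
  intro _ _ _ _ h
  exact add_left_cancel h

open Classical in
/-- The walks from `v` with `m` steps in the chamber of partitions, continued by the constant
sequence at their end. -/
noncomputable def chamberWalks : ℕ → Shape → Finset (ℕ → Shape)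
  | 0, v => {fun _ => v}
  | m + 1, v => v.neighbors.biUnion fun u =>
      (chamberWalks m u).image fun w k => Nat.casesOn k v w

theorem mem_chamberWalks {m : ℕ} {v : Shape} (hv : v.IsPartition) {w : ℕ → Shape} :
    w ∈ chamberWalks m v ↔
      w 0 = v ∧ (∀ k < m, (w k).Adj (w (k + 1))) ∧ ∀ k, m ≤ k → w k = w m := by
  induction m generalizing v w with
  | zero =>
    simp only [chamberWalks, Finset.mem_singleton]
    constructor
    · rintro rfl
      simp
    · rintro ⟨h0, -, h⟩
      funext k
      rw [h k (Nat.zero_le _), h0]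
  | succ m ih =>
    simp only [chamberWalks, Finset.mem_biUnion, Finset.mem_image]
    constructor
    · rintro ⟨u, hu, w, hw, rfl⟩
      have hu' := (Shape.mem_neighbors hv).1 hu
      rw [Shape.neighbors, Finset.mem_filter] at hu
      obtain ⟨h0, h1, h2⟩ := (ih hu.2).1 hw
      refine ⟨rfl, fun k hk => ?_, fun k hk => ?_⟩
      · cases k with
        | zero => simpa [h0] using hu'
        | succ k => exact h1 k (by omega)
      · cases k with
        | zero => omega
        | succ k => exact h2 k (by omega)
    · rintro ⟨h0, h1, h2⟩
      have ha := h1 0 (by omega)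
      rw [h0] at ha
      have hu := (Shape.mem_neighbors hv).2 ha
      refine ⟨w 1, hu, fun k => w (k + 1), (ih ?_).2 ⟨rfl, fun k hk => h1 (k + 1) (by omega),
        fun k hk => h2 (k + 1) (by omega)⟩, ?_⟩
      · rw [Shape.neighbors, Finset.mem_filter] at hu
        exact hu.2
      · funext k
        cases k with
        | zero => exact h0.symm
        | succ k => rfl

theorem card_chamberWalks_succ (m : ℕ) (v : Shape) :
    (chamberWalks (m + 1) v).card = ∑ u ∈ v.neighbors, (chamberWalks m u).card := by
  classical
  rw [chamberWalks, Finset.card_biUnion]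
  · refine Finset.sum_congr rfl fun u _ => ?_
    refine Finset.card_image_of_injective _ fun w w' h => funext fun k => ?_
    exact congrFun h (k + 1)
  · intro u hu u' hu' hne
    rw [Function.onFun, Finset.disjoint_left]
    simp only [Finset.mem_image]
    rintro _ ⟨w, hw, rfl⟩ ⟨w', hw', h⟩
    have h1 : w' 0 = w 0 := congrFun h 1
    rw [Shape.neighbors] at hu hu'
    rw [((mem_chamberWalks (Finset.mem_filter.1 hu).2).1 hw).1,
      ((mem_chamberWalks (Finset.mem_filter.1 hu').2).1 hw').1] at h1
    exact hne h1.symm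

/-- Both sides obey the same recurrence in the starting point. A step leaving the chamber lands,
after the shift by (3, 2, 1), on a wall where `tripleEGF` is zero. The bound on `L` is inherited, as
a step raises x by at most one. -/
theorem card_chamberWalks_eq_tripleEGF (L m x y z : ℕ) (hzy : z ≤ y) (hyx : y ≤ x)
    (hL : x + m + 3 ≤ L) :
    ((chamberWalks m (x, y, z)).card : ℚ) = egfCoeff m (tripleEGF L (x + 3) (y + 2) (z + 1)) := by
  induction m generalizing x y z with
  | zero =>
    rw [egfCoeff_zero, constantCoeff_tripleEGF L _ _ _ (by omega) (by omega) (by omega) (by omega)]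
    simp [chamberWalks]
  | succ m ih =>
    rw [egfCoeff_succ, derivative_tripleEGF, card_chamberWalks_succ, Shape.sum_neighbors]
    have e1 : (if Shape.IsPartition ((x + 1 : ℤ), (y : ℤ), (z : ℤ))
        then ((chamberWalks m ((x + 1 : ℤ), (y : ℤ), (z : ℤ))).card : ℚ) else 0) =
        egfCoeff m (tripleEGF L (x + 4) (y + 2) (z + 1)) := by
      rw [if_pos (by simp only [Shape.IsPartition]; omega)]
      exact_mod_cast ih (x + 1) y z hzy (by omega) (by omega)
    have e2 : (if Shape.IsPartition ((x - 1 : ℤ), (y : ℤ), (z : ℤ))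
        then ((chamberWalks m ((x - 1 : ℤ), (y : ℤ), (z : ℤ))).card : ℚ) else 0) =
        egfCoeff m (tripleEGF L (x + 2) (y + 2) (z + 1)) := by
      split_ifs with h
      · simp only [Shape.IsPartition] at h
        obtain ⟨x, rfl⟩ : ∃ x', x = x' + 1 := ⟨x - 1, by omega⟩
        simpa using ih x y z hzy (by omega) (by omega)
      · simp only [Shape.IsPartition] at h
        obtain rfl : x = y := by omega
        rw [tripleEGF_left]; simp [egfCoeff]
    have e3 : (if Shape.IsPartition ((x : ℤ), (y + 1 : ℤ), (z : ℤ))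
        then ((chamberWalks m ((x : ℤ), (y + 1 : ℤ), (z : ℤ))).card : ℚ) else 0) =
        egfCoeff m (tripleEGF L (x + 3) (y + 3) (z + 1)) := by
      split_ifs with h
      · simp only [Shape.IsPartition] at h
        exact_mod_cast ih x (y + 1) z (by omega) (by omega) (by omega)
      · simp only [Shape.IsPartition] at h
        obtain rfl : x = y := by omega
        rw [tripleEGF_left]; simp [egfCoeff]
    have e4 : (if Shape.IsPartition ((x : ℤ), (y - 1 : ℤ), (z : ℤ))
        then ((chamberWalks m ((x : ℤ), (y - 1 : ℤ), (z : ℤ))).card : ℚ) else 0) =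
        egfCoeff m (tripleEGF L (x + 3) (y + 1) (z + 1)) := by
      split_ifs with h
      · simp only [Shape.IsPartition] at h
        obtain ⟨y, rfl⟩ : ∃ y', y = y' + 1 := ⟨y - 1, by omega⟩
        simpa using ih x y z (by omega) (by omega) (by omega)
      · simp only [Shape.IsPartition] at h
        obtain rfl : y = z := by omega
        rw [tripleEGF_right]; simp [egfCoeff]
    have e5 : (if Shape.IsPartition ((x : ℤ), (y : ℤ), (z + 1 : ℤ))
        then ((chamberWalks m ((x : ℤ), (y : ℤ), (z + 1 : ℤ))).card : ℚ) else 0) =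
        egfCoeff m (tripleEGF L (x + 3) (y + 2) (z + 2)) := by
      split_ifs with h
      · simp only [Shape.IsPartition] at h
        exact_mod_cast ih x y (z + 1) (by omega) (by omega) (by omega)
      · simp only [Shape.IsPartition] at h
        obtain rfl : y = z := by omega
        rw [tripleEGF_right]; simp [egfCoeff]
    have e6 : (if Shape.IsPartition ((x : ℤ), (y : ℤ), (z - 1 : ℤ))
        then ((chamberWalks m ((x : ℤ), (y : ℤ), (z - 1 : ℤ))).card : ℚ) else 0) =
        egfCoeff m (tripleEGF L (x + 3) (y + 2) z) := by
      split_ifs with h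
      · simp only [Shape.IsPartition] at h
        obtain ⟨z, rfl⟩ : ∃ z', z = z' + 1 := ⟨z - 1, by omega⟩
        simpa using ih x y z (by omega) (by omega) (by omega)
      · simp only [Shape.IsPartition] at h
        obtain rfl : z = 0 := by omega
        rw [tripleEGF_zero]; simp [egfCoeff]
    simp only [egfCoeff_add, ← e1, ← e2, ← e3, ← e4, ← e5, ← e6]
    simp only [unitSteps]
    rw [Finset.sum_insert (by decide), Finset.sum_insert (by decide), Finset.sum_insert (by decide),
      Finset.sum_insert (by decide), Finset.sum_insert (by decide), Finset.sum_singleton]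
    simp only [Prod.mk_add_mk, add_zero, ← sub_eq_add_neg]
    push_cast
    ring

theorem card_chamberWalks (m : ℕ) :
    ((chamberWalks m 0).card : ℚ) = egfCoeff m ((lineEGF 0 - lineEGF 2)
      * ((lineEGF 0 + lineEGF 1) * (lineEGF 0 + lineEGF 3) - (lineEGF 1 + lineEGF 2) ^ 2)) := by
  rw [← egfCoeff_tripleEGF_three_two_one m (m + 3) le_rfl]
  exact_mod_cast card_chamberWalks_eq_tripleEGF (m + 3) m 0 0 0 le_rfl le_rfl (by omega)

/-! ### Growth diagrams over a triangle. -/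

theorem Shape.isPartition_zero : (0 : Shape).IsPartition :=
  ⟨le_rfl, le_rfl, le_rfl⟩

theorem Shape.step_refl {v : Shape} (hv : v.IsPartition) : v.Step v :=
  ⟨hv, hv, le_rfl, le_rfl, le_rfl, by omega⟩

theorem Shape.Step.eq_zero {v : Shape} (h : v.Step 0) : v = 0 := by
  obtain ⟨a, b, c⟩ := v
  simp only [Step, IsPartition, Prod.fst_zero, Prod.snd_zero] at h
  ext <;> simp <;> omega

theorem Shape.Step.eq_of_size {u v : Shape} (h : u.Step v) (hs : u.size = v.size) : u = v := by
  obtain ⟨a, b, c⟩ := v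
  obtain ⟨x, y, z⟩ := u
  simp only [Step, IsPartition, size] at h hs
  ext <;> simp <;> omega

theorem Shape.Step.size_le {u v : Shape} (h : u.Step v) :
    u.size ≤ v.size ∧ v.size ≤ u.size + 1 := by
  simp only [Step, size] at *
  omega

theorem Shape.Adj.isPartition {u v : Shape} (h : u.Adj v) : u.IsPartition ∧ v.IsPartition := by
  rcases h.1 with h | h
  · exact ⟨h.1, h.2.1⟩
  · exact ⟨h.2.1, h.1⟩

/-- A common lower neighbor of two adjacent shapes is the smaller one of them. -/
theorem Shape.Adj.eq_smaller {u v μ : Shape} (h : u.Adj v) (hu : μ.Step u) (hv : μ.Step v) :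
    (μ = u ∧ v.size = μ.size + 1) ∨ (μ = v ∧ u.size = μ.size + 1) := by
  have h1 := hu.size_le
  have h2 := hv.size_le
  have h3 := h.2
  rcases eq_or_ne μ.size u.size with h4 | h4
  · exact Or.inl ⟨hu.eq_of_size h4, by omega⟩
  · exact Or.inr ⟨hv.eq_of_size (by omega), by omega⟩

/-- A bijective local rule for growth diagrams of shapes with at most three parts:
`Rel μ ν ρ x r` means that a cell with the corners `μ` (lower left), `ν`, `ρ`
and `r` (upper right) is marked if and only if `x` holds. -/
structure LocalRule where
  /-- The relation between the four corners of a cell and its mark. -/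
  Rel : Shape → Shape → Shape → Prop → Shape → Prop
  steps : ∀ {μ ν ρ x r}, Rel μ ν ρ x r → μ.Step ν ∧ μ.Step ρ ∧ ν.Step r ∧ ρ.Step r
  size_of_marked : ∀ {μ ν ρ x r}, Rel μ ν ρ x r → x → r.size + μ.size = ν.size + ρ.size + 1
  size_of_unmarked : ∀ {μ ν ρ x r}, Rel μ ν ρ x r → ¬ x → r.size + μ.size = ν.size + ρ.size
  symm : ∀ {μ ν ρ x r}, Rel μ ν ρ x r → Rel μ ρ ν x r
  -- Existence is demanded only backwards. Going forward a fourth part may be needed, and this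
  -- failure is what detects crossings or nestings.
  exists_backward : ∀ {ν ρ r}, ν.Step r → ρ.Step r → ∃ μ x, Rel μ ν ρ x r
  backward_unique : ∀ {μ μ' ν ρ r x x'}, Rel μ ν ρ x r → Rel μ' ν ρ x' r → μ = μ' ∧ (x ↔ x')
  forward_unique : ∀ {μ ν ρ r r' x}, Rel μ ν ρ x r → Rel μ ν ρ x r' → r = r'

/-- A growth diagram on the triangle of the vertices `(a, b)` with `a + b ≤ N`. -/
structure IsGrowth (R : LocalRule) (N : ℕ) (X : ℕ → ℕ → Prop) (F : ℕ → ℕ → Shape) : Prop where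
  left : ∀ b ≤ N, F 0 b = 0
  bottom : ∀ a ≤ N, F a 0 = 0
  cell : ∀ a b, a + b + 2 ≤ N →
    R.Rel (F a b) (F (a + 1) b) (F a (b + 1)) (X a b) (F (a + 1) (b + 1))

namespace IsGrowth

variable {R : LocalRule} {N : ℕ} {X X' : ℕ → ℕ → Prop} {F F' : ℕ → ℕ → Shape}

theorem swap (h : IsGrowth R N X F) : IsGrowth R N (fun a b => X b a) fun a b => F b a :=
  ⟨h.bottom, h.left, fun a b hab => R.symm (h.cell b a (by omega))⟩

theorem congr (h : IsGrowth R N X F) (hX : ∀ a b, a + b + 2 ≤ N → (X a b ↔ X' a b)) :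
    IsGrowth R N X' F :=
  ⟨h.left, h.bottom, fun a b hab => (propext (hX a b hab)) ▸ h.cell a b hab⟩

theorem step_right (h : IsGrowth R N X F) {a b : ℕ} (hab : a + b + 1 ≤ N) :
    (F a b).Step (F (a + 1) b) := by
  cases b with
  | zero =>
    rw [h.bottom a (by omega), h.bottom (a + 1) (by omega)]
    exact Shape.step_refl Shape.isPartition_zero
  | succ b => exact (R.steps (h.cell a b (by omega))).2.2.2

theorem step_up (h : IsGrowth R N X F) {a b : ℕ} (hab : a + b + 1 ≤ N) :
    (F a b).Step (F a (b + 1)) :=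
  h.swap.step_right (by omega)

theorem forward_unique (h : IsGrowth R N X F) (h' : IsGrowth R N X F') :
    ∀ a b, a + b ≤ N → F a b = F' a b := by
  intro a
  induction a with
  | zero =>
    intro b hb
    rw [h.left b (by omega), h'.left b (by omega)]
  | succ a iha =>
    intro b
    induction b with
    | zero =>
      intro hb
      rw [h.bottom _ (by omega), h'.bottom _ (by omega)]
    | succ b ihb =>
      intro hb
      have h1 := h.cell a b (by omega)
      have h2 := h'.cell a b (by omega)
      rw [iha b (by omega), iha (b + 1) (by omega), ihb (by omega)] at h1
      exact R.forward_unique h1 h2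

theorem backward_unique (h : IsGrowth R N X F) (h' : IsGrowth R N X' F')
    (hadj : ∀ a b, a + b + 1 = N → (F a (b + 1)).Adj (F (a + 1) b))
    (hdiag : ∀ a b, a + b = N → F a b = F' a b) :
    (∀ a b, a + b ≤ N → F a b = F' a b) ∧ ∀ a b, a + b + 2 ≤ N → (X a b ↔ X' a b) := by
  have h0 : ∀ d, ∀ a b, a + b + d = N → F a b = F' a b := by
    intro d
    induction d using Nat.twoStepInduction with
    | zero => exact hdiag
    -- No cell of the triangle fills this gap next to the hypotenuse. The vertex lies below two
    -- adjacent shapes, so it is the smaller of them.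
    | one =>
      intro a b hab
      have e1 := hdiag a (b + 1) (by omega)
      have e2 := hdiag (a + 1) b (by omega)
      have hA := hadj a b hab
      have hA' := hA
      rw [e1, e2] at hA'
      have c1 := hA.eq_smaller (h.step_up (by omega)) (h.step_right (by omega))
      have c2 := hA'.eq_smaller (h'.step_up (by omega)) (h'.step_right (by omega))
      rcases c1 with ⟨c1, s1⟩ | ⟨c1, s1⟩ <;> rcases c2 with ⟨c2, s2⟩ | ⟨c2, s2⟩
      · rw [c1, c2, e1]
      · rw [c1, e1, e2] at s1
        rw [c2] at s2
        omega
      · rw [c1, e1, e2] at s1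
        rw [c2] at s2
        omega
      · rw [c1, c2, e2]
    | more d ih0 ih1 =>
      intro a b hab
      have c1 := h.cell a b (by omega)
      have c2 := h'.cell a b (by omega)
      rw [ih1 (a + 1) b (by omega), ih1 a (b + 1) (by omega),
        ih0 (a + 1) (b + 1) (by omega)] at c1
      exact (R.backward_unique c1 c2).1
  have h1 : ∀ a b, a + b ≤ N → F a b = F' a b := fun a b hab =>
    h0 (N - (a + b)) a b (by omega)
  refine ⟨h1, fun a b hab => ?_⟩
  have c1 := h.cell a b hab
  have c2 := h'.cell a b hab
  rw [h1 (a + 1) b (by omega), h1 a (b + 1) (by omega), h1 (a + 1) (b + 1) (by omega)] at c1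
  exact (R.backward_unique c1 c2).2

end IsGrowth

/-- A counter that starts at 0, rises by one at each mark and never exceeds 1 meets at most one
mark. It is applied to size differences across a strip of cells, where `Step` gives the bound 1. -/
theorem exists_unique_of_increments {x : ℕ → Prop} {d : ℕ → ℤ} {n : ℕ} (h0 : d 0 = 0)
    (hm : ∀ k < n, x k → d (k + 1) = d k + 1) (hu : ∀ k < n, ¬ x k → d (k + 1) = d k)
    (h1 : ∀ k ≤ n, d k ≤ 1) :
    ((d n = 0 ∧ ∀ k < n, ¬ x k) ∨ (d n = 1 ∧ ∃ k < n, x k)) ∧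
      ∀ k < n, ∀ l < n, x k → x l → k = l := by
  induction n with
  | zero => simp [h0]
  | succ n ih =>
    obtain ⟨c, u⟩ := ih (fun k hk => hm k (by omega)) (fun k hk => hu k (by omega))
      (fun k hk => h1 k (by omega))
    by_cases hx : x n
    · have e := hm n (by omega) hx
      have l := h1 (n + 1) le_rfl
      rcases c with ⟨c, hc⟩ | ⟨c, -⟩
      · refine ⟨Or.inr ⟨by omega, n, by omega, hx⟩, fun k hk l hl xk xl => ?_⟩
        have k' : ¬ k < n := fun h => hc k h xk
        have l' : ¬ l < n := fun h => hc l h xl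
        omega
      · omega
    · have e := hu n (by omega) hx
      refine ⟨?_, fun k hk l hl xk xl => ?_⟩
      · rcases c with ⟨c, hc⟩ | ⟨c, k, hk, xk⟩
        · refine Or.inl ⟨by omega, fun k hk xk => ?_⟩
          rcases Nat.lt_succ_iff_lt_or_eq.1 hk with h | rfl
          · exact hc k h xk
          · exact hx xk
        · exact Or.inr ⟨by omega, k, by omega, xk⟩
      · have k' : k ≠ n := by rintro rfl; exact hx xk
        have l' : l ≠ n := by rintro rfl; exact hx xl
        exact u k (by omega) l (by omega) xk xl

namespace IsGrowth

variable {R : LocalRule} {N : ℕ} {X : ℕ → ℕ → Prop} {F : ℕ → ℕ → Shape}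

theorem row_marks (h : IsGrowth R N X F) {a b : ℕ} (hab : a + b + 1 ≤ N) :
    (((F (a + 1) b).size = (F a b).size ∧ ∀ k < b, ¬ X a k) ∨
      ((F (a + 1) b).size = (F a b).size + 1 ∧ ∃ k < b, X a k)) ∧
      ∀ k < b, ∀ l < b, X a k → X a l → k = l := by
  have := exists_unique_of_increments (x := X a) (n := b)
    (d := fun k => (F (a + 1) k).size - (F a k).size)
    (by rw [h.bottom a (by omega), h.bottom (a + 1) (by omega), sub_self])
    (fun k hk hx => by
      have := R.size_of_marked (h.cell a k (by omega)) hx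
      omega)
    (fun k hk hx => by
      have := R.size_of_unmarked (h.cell a k (by omega)) hx
      omega)
    (fun k hk => by
      have := (h.step_right (show a + k + 1 ≤ N by omega)).size_le
      omega)
  refine ⟨this.1.imp (fun t => ⟨by omega, t.2⟩) (fun t => ⟨by omega, t.2⟩), this.2⟩

theorem column_marks (h : IsGrowth R N X F) {a b : ℕ} (hab : a + b + 1 ≤ N) :
    (((F a (b + 1)).size = (F a b).size ∧ ∀ k < a, ¬ X k b) ∨
      ((F a (b + 1)).size = (F a b).size + 1 ∧ ∃ k < a, X k b)) ∧
      ∀ k < a, ∀ l < a, X k b → X l b → k = l :=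
  h.swap.row_marks (by omega)

end IsGrowth

/-- Each hook of the triangle contains exactly one mark. -/
structure IsPerfect (N : ℕ) (X : ℕ → ℕ → Prop) : Prop where
  -- For the marks of a matching, this hook holds the arcs that open (row) or close (column) at the
  -- point a + 1 = N − b.
  row_or_column : ∀ a b, a + b + 1 = N → (∃ k < b, X a k) ∨ ∃ k < a, X k b
  not_both : ∀ a b, a + b + 1 = N → ∀ k < b, ∀ l < a, X a k → ¬ X l b
  row_unique : ∀ a b, a + b + 1 = N → ∀ k < b, ∀ l < b, X a k → X a l → k = l
  column_unique : ∀ a b, a + b + 1 = N → ∀ k < a, ∀ l < a, X k b → X l b → k = l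

namespace IsGrowth

variable {R : LocalRule} {N : ℕ} {X : ℕ → ℕ → Prop} {F : ℕ → ℕ → Shape}

/-- Size grows across an edge exactly when the strip behind it holds a mark. Hence the hypotenuse
steps up for a mark in the row of the hook and down for one in its column; adjacency excludes both
and neither. -/
theorem isPerfect (h : IsGrowth R N X F)
    (hadj : ∀ a b, a + b + 1 = N → (F a (b + 1)).Adj (F (a + 1) b)) : IsPerfect N X where
  row_or_column a b hab := by
    have hs := (hadj a b hab).2
    rcases (h.row_marks hab.le).1 with ⟨r, -⟩ | ⟨-, r⟩
    · rcases (h.column_marks hab.le).1 with ⟨c, -⟩ | ⟨-, c⟩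
      · omega
      · exact Or.inr c
    · exact Or.inl r
  not_both a b hab k hk l hl xk xl := by
    have hs := (hadj a b hab).2
    rcases (h.row_marks hab.le).1 with ⟨-, r⟩ | ⟨r, -⟩
    · exact r k hk xk
    · rcases (h.column_marks hab.le).1 with ⟨-, c⟩ | ⟨c, -⟩
      · exact c l hl xl
      · omega
  row_unique a b hab := (h.row_marks hab.le).2
  column_unique a b hab := (h.column_marks hab.le).2

theorem adj (h : IsGrowth R N X F) (hX : IsPerfect N X) {a b : ℕ} (hab : a + b + 1 = N) :
    (F a (b + 1)).Adj (F (a + 1) b) := by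
  have hr := h.step_right hab.le
  have hu := h.step_up hab.le
  rcases (h.row_marks hab.le).1 with ⟨r, xr⟩ | ⟨r, k, hk, xk⟩
  · rcases (h.column_marks hab.le).1 with ⟨c, xc⟩ | ⟨c, l, hl, xl⟩
    · rcases hX.row_or_column a b hab with ⟨k, hk, xk⟩ | ⟨k, hk, xk⟩
      · exact absurd xk (xr k hk)
      · exact absurd xk (xc k hk)
    · rw [hr.eq_of_size r.symm] at hu
      exact ⟨Or.inr hu, by omega⟩
  · rcases (h.column_marks hab.le).1 with ⟨c, xc⟩ | ⟨c, l, hl, xl⟩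
    · rw [hu.eq_of_size c.symm] at hr
      exact ⟨Or.inl hr, by omega⟩
    · exact absurd xl (hX.not_both a b hab k hk l hl xk)

end IsGrowth

open Classical in
/-- The growth diagram with prescribed shapes on its hypotenuse: the shape at the vertex
`(a, N - d - a)`. -/
noncomputable def backwardGrowth (R : LocalRule) (w : ℕ → Shape) : ℕ → ℕ → Shape
  | 0, a => w a
  | 1, a => if (w a).size ≤ (w (a + 1)).size then w a else w (a + 1)
  | d + 2, a =>
    if h : ∃ μ x, R.Rel μ (backwardGrowth R w (d + 1) (a + 1)) (backwardGrowth R w (d + 1) a) x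
        (backwardGrowth R w d (a + 1)) then h.choose else 0

theorem backwardGrowth_steps (R : LocalRule) (w : ℕ → Shape) (N : ℕ)
    (hw : ∀ k < N, (w k).Adj (w (k + 1))) (d a : ℕ) (h : a + d + 1 ≤ N) :
    (backwardGrowth R w (d + 1) a).Step (backwardGrowth R w d a) ∧
      (backwardGrowth R w (d + 1) a).Step (backwardGrowth R w d (a + 1)) := by
  induction d generalizing a with
  | zero =>
    have hA := hw a (by omega)
    rw [backwardGrowth, backwardGrowth, backwardGrowth]
    split_ifs with hs
    · refine ⟨Shape.step_refl hA.isPartition.1, hA.1.resolve_right fun h => ?_⟩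
      have := h.size_le
      have := hA.2
      omega
    · refine ⟨hA.1.resolve_left fun h => ?_, Shape.step_refl hA.isPartition.2⟩
      have := h.size_le
      omega
  | succ d ih =>
    have h1 := (ih (a + 1) (by omega)).1
    have h2 := (ih a (by omega)).2
    have h3 := R.exists_backward h1 h2
    rw [backwardGrowth, dif_pos h3]
    obtain ⟨x, hx⟩ := h3.choose_spec
    have := R.steps hx
    exact ⟨this.2.1, this.1⟩

theorem exists_isGrowth (R : LocalRule) (N : ℕ) (w : ℕ → Shape)
    (hw : ∀ k < N, (w k).Adj (w (k + 1))) (h0 : w 0 = 0) (hN : w N = 0) :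
    ∃ X F, IsGrowth R N X F ∧ ∀ a b, a + b = N → F a b = w a := by
  have hst := backwardGrowth_steps R w N hw
  set G := backwardGrowth R w with hG
  let F : ℕ → ℕ → Shape := fun a b => G (N - (a + b)) a
  have hF : ∀ a b, F a b = G (N - (a + b)) a := fun _ _ => rfl
  -- The marks are read off afterwards: a cell is marked when its four corners fit the rule for a
  -- marked cell. The legs are empty because only ∅ steps to ∅.
  refine ⟨fun a b => R.Rel (F a b) (F (a + 1) b) (F a (b + 1)) True (F (a + 1) (b + 1)), F,
    ⟨fun b hb => ?_, fun a ha => ?_, fun a b hab => ?_⟩, fun a b hab => ?_⟩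
  · have : ∀ d ≤ N, G d 0 = 0 := by
      intro d
      induction d with
      | zero => intro _; exact h0
      | succ d ih =>
        intro hd
        have := (hst d 0 (by omega)).1
        rw [ih (by omega)] at this
        exact this.eq_zero
    exact this _ (by omega)
  · have : ∀ d a, a + d = N → G d a = 0 := by
      intro d
      induction d with
      | zero =>
        intro a ha
        rw [add_zero] at ha
        rw [ha]
        exact hN
      | succ d ih =>
        intro a hd
        have := (hst d a (by omega)).2
        rw [ih (a + 1) (by omega)] at this
        exact this.eq_zero
    exact this _ a (by omega)
  · obtain ⟨d, hd⟩ : ∃ d, N = a + b + 2 + d := ⟨N - (a + b + 2), by omega⟩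
    have e1 : F a b = G (d + 2) a := by rw [hF]; congr 1; omega
    have e2 : F (a + 1) b = G (d + 1) (a + 1) := by rw [hF]; congr 1; omega
    have e3 : F a (b + 1) = G (d + 1) a := by rw [hF]; congr 1; omega
    have e4 : F (a + 1) (b + 1) = G d (a + 1) := by rw [hF]; congr 1; omega
    have h3 := R.exists_backward (hst d (a + 1) (by omega)).1 (hst d a (by omega)).2
    have e5 : F a b = h3.choose := by
      rw [e1]
      exact (by rw [backwardGrowth]; exact dif_pos h3 : backwardGrowth R w (d + 2) a = h3.choose)
    obtain ⟨x, hx⟩ := h3.choose_spec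
    rw [← e5, ← e2, ← e3, ← e4] at hx
    by_cases x0 : x
    · have : x = True := eq_true x0
      rw [this] at hx
      rwa [eq_true hx]
    · have : x = False := eq_false x0
      rw [this] at hx
      have hn : ¬ R.Rel (F a b) (F (a + 1) b) (F a (b + 1)) True (F (a + 1) (b + 1)) :=
        fun h => (R.backward_unique h hx).2.1 trivial
      rwa [eq_false hn]
  · rw [hF, hab, Nat.sub_self, hG, backwardGrowth]

/-! ### Matchings as perfect sets of marks. -/

/-- The cell of the arc `(i, j)` is `(i - 1, N - j)`: the marks of the arcs of `M`. -/
def arcMarks {n : ℕ} (M : Finpartition (Finset.Icc 1 (2 * n))) (a b : ℕ) : Prop :=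
  IsArc M (a + 1) (2 * n - b)

theorem arcBlock_injective {N a b a' b' : ℕ} (h : a + b + 2 ≤ N) (h' : a' + b' + 2 ≤ N)
    (e : ({a + 1, N - b} : Finset ℕ) = {a' + 1, N - b'}) : a = a' ∧ b = b' := by
  have h1 : a + 1 ∈ ({a' + 1, N - b'} : Finset ℕ) := e ▸ by simp
  have h2 : N - b ∈ ({a' + 1, N - b'} : Finset ℕ) := e ▸ by simp
  have h3 : a' + 1 ∈ ({a + 1, N - b} : Finset ℕ) := e ▸ by simp
  have h4 : N - b' ∈ ({a + 1, N - b} : Finset ℕ) := e ▸ by simp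
  simp only [Finset.mem_insert, Finset.mem_singleton] at h1 h2 h3 h4
  omega

section Marks

variable {n : ℕ} {M M' : Finpartition (Finset.Icc 1 (2 * n))}

theorem arcMarks_iff {a b : ℕ} (h : a + b + 2 ≤ 2 * n) :
    arcMarks M a b ↔ ({a + 1, 2 * n - b} : Finset ℕ) ∈ M.parts := by
  rw [arcMarks, IsArc, and_iff_right (by omega)]

theorem IsMatching.exists_arcMarks (hM : IsMatching M) {B : Finset ℕ} (hB : B ∈ M.parts) :
    ∃ a b, a + b + 2 ≤ 2 * n ∧ arcMarks M a b ∧ B = {a + 1, 2 * n - b} := by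
  obtain ⟨x, y, hxy, rfl⟩ := Finset.card_eq_two.1 (hM B hB)
  have key : ∀ x y : ℕ, x < y → ({x, y} : Finset ℕ) ∈ M.parts →
      ∃ a b, a + b + 2 ≤ 2 * n ∧ arcMarks M a b ∧ ({x, y} : Finset ℕ) = {a + 1, 2 * n - b} := by
    intro x y hxy hB
    have hs := M.le hB
    have hx := hs (show x ∈ ({x, y} : Finset ℕ) by simp)
    have hy := hs (show y ∈ ({x, y} : Finset ℕ) by simp)
    rw [Finset.mem_Icc] at hx hy
    have e1 : x - 1 + 1 = x := by omega
    have e2 : 2 * n - (2 * n - y) = y := by omega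
    refine ⟨x - 1, 2 * n - y, by omega, ?_, by rw [e1, e2]⟩
    rw [arcMarks_iff (by omega), e1, e2]
    exact hB
  rcases lt_or_gt_of_ne hxy with h | h
  · exact key x y h hB
  · rw [Finset.pair_comm] at hB ⊢
    exact key y x h hB

theorem IsMatching.ext_arcMarks (hM : IsMatching M) (hM' : IsMatching M')
    (h : ∀ a b, a + b + 2 ≤ 2 * n → (arcMarks M a b ↔ arcMarks M' a b)) : M = M' := by
  ext B
  constructor
  · intro hB
    obtain ⟨a, b, hab, hX, rfl⟩ := hM.exists_arcMarks hB
    exact (arcMarks_iff hab).1 ((h a b hab).1 hX)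
  · intro hB
    obtain ⟨a, b, hab, hX, rfl⟩ := hM'.exists_arcMarks hB
    exact (arcMarks_iff hab).1 ((h a b hab).2 hX)

theorem arcMarks_unique {a b a' b' : ℕ} (h : a + b + 2 ≤ 2 * n) (h' : a' + b' + 2 ≤ 2 * n)
    (hX : arcMarks M a b) (hX' : arcMarks M a' b') {k : ℕ}
    (hk : k = a + 1 ∨ k = 2 * n - b) (hk' : k = a' + 1 ∨ k = 2 * n - b') : a = a' ∧ b = b' := by
  refine arcBlock_injective h h' (M.eq_of_mem_parts ((arcMarks_iff h).1 hX)
    ((arcMarks_iff h').1 hX') (a := k) ?_ ?_) <;> simpa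

theorem IsMatching.isPerfect (hM : IsMatching M) : IsPerfect (2 * n) (arcMarks M) where
  row_or_column a b hab := by
    obtain ⟨B, hB, hk⟩ := M.exists_mem (show a + 1 ∈ Finset.Icc 1 (2 * n) by
      rw [Finset.mem_Icc]; omega)
    obtain ⟨a', b', h, hX, rfl⟩ := hM.exists_arcMarks hB
    simp only [Finset.mem_insert, Finset.mem_singleton] at hk
    rcases hk with hk | hk
    · obtain rfl : a = a' := by omega
      exact Or.inl ⟨b', by omega, hX⟩
    · obtain rfl : b = b' := by omega
      exact Or.inr ⟨a', by omega, hX⟩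
  not_both a b hab k hk l hl xk xl := by
    have := arcMarks_unique (by omega) (by omega) xk xl (k := a + 1) (by omega) (by omega)
    omega
  row_unique a b hab k hk l hl xk xl :=
    (arcMarks_unique (by omega) (by omega) xk xl (k := a + 1) (by omega) (by omega)).2
  column_unique a b hab k hk l hl xk xl :=
    (arcMarks_unique (by omega) (by omega) xk xl (k := a + 1) (by omega) (by omega)).1

theorem image_reflection_arcBlock {N a b : ℕ} (h : a + b + 2 ≤ N) :
    ({a + 1, N - b} : Finset ℕ).image (fun x => N + 1 - x) = {b + 1, N - a} := by
  rw [Finset.image_insert, Finset.image_singleton, Finset.pair_comm]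
  congr 1
  · omega
  · congr 1; omega

/-- The reflection sends the block of the cell (a, b) to that of (b, a), so it transposes the
triangle. -/
theorem IsMatching.isBilaterallySymmetric_iff (hM : IsMatching M) :
    IsBilaterallySymmetric M ↔
      ∀ a b, a + b + 2 ≤ 2 * n → (arcMarks M a b ↔ arcMarks M b a) := by
  constructor
  · intro hs
    have key : ∀ a b, a + b + 2 ≤ 2 * n → arcMarks M a b → arcMarks M b a := by
      intro a b hab hX
      rw [arcMarks_iff hab] at hX
      rw [arcMarks_iff (by omega), ← image_reflection_arcBlock hab, ← hs]
      exact Finset.mem_image_of_mem _ hX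
    exact fun a b hab => ⟨key a b hab, key b a (by omega)⟩
  · intro hX
    rw [IsBilaterallySymmetric]
    ext B
    rw [Finset.mem_image]
    constructor
    · rintro ⟨C, hC, rfl⟩
      obtain ⟨a, b, hab, hx, rfl⟩ := hM.exists_arcMarks hC
      rw [image_reflection_arcBlock hab, ← arcMarks_iff (by omega)]
      exact (hX a b hab).1 hx
    · intro hB
      obtain ⟨a, b, hab, hx, rfl⟩ := hM.exists_arcMarks hB
      refine ⟨{b + 1, 2 * n - a}, (arcMarks_iff (by omega)).1 ((hX a b hab).1 hx), ?_⟩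
      exact image_reflection_arcBlock (by omega)

end Marks

theorem IsPerfect.exists_matching {n : ℕ} {X : ℕ → ℕ → Prop} (hX : IsPerfect (2 * n) X) :
    ∃ M : Finpartition (Finset.Icc 1 (2 * n)), IsMatching M ∧
      ∀ a b, a + b + 2 ≤ 2 * n → (arcMarks M a b ↔ X a b) := by
  classical
  let P : Finset (Finset ℕ) :=
    ((Finset.range (2 * n) ×ˢ Finset.range (2 * n)).filter fun p =>
      p.1 + p.2 + 2 ≤ 2 * n ∧ X p.1 p.2).image fun p => {p.1 + 1, 2 * n - p.2}
  have hP : ∀ B, B ∈ P ↔ ∃ a b, a + b + 2 ≤ 2 * n ∧ X a b ∧ B = {a + 1, 2 * n - b} := by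
    intro B
    simp only [P, Finset.mem_image, Finset.mem_filter, Finset.mem_product, Finset.mem_range,
      Prod.exists]
    constructor
    · rintro ⟨a, b, ⟨-, h1, h2⟩, rfl⟩
      exact ⟨a, b, h1, h2, rfl⟩
    · rintro ⟨a, b, h1, h2, rfl⟩
      exact ⟨a, b, ⟨⟨by omega, by omega⟩, h1, h2⟩, rfl⟩
  have huniq : ∀ a b a' b', a + b + 2 ≤ 2 * n → a' + b' + 2 ≤ 2 * n → X a b → X a' b' →
      ∀ k, (k = a + 1 ∨ k = 2 * n - b) → (k = a' + 1 ∨ k = 2 * n - b') → a = a' ∧ b = b' := by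
    intro a b a' b' h h' x x' k hk hk'
    rcases hk with hk | hk <;> rcases hk' with hk' | hk'
    · obtain rfl : a = a' := by omega
      exact ⟨rfl, hX.row_unique a (2 * n - 1 - a) (by omega) b (by omega) b' (by omega) x x'⟩
    · exact absurd x' (hX.not_both a b' (by omega) b (by omega) a' (by omega) x)
    · exact absurd x (hX.not_both a' b (by omega) b' (by omega) a (by omega) x')
    · obtain rfl : b = b' := by omega
      exact ⟨hX.column_unique (2 * n - 1 - b) b (by omega) a (by omega) a' (by omega) x x', rfl⟩
  have hcover : ∀ k ∈ Finset.Icc 1 (2 * n), ∃! B, B ∈ P ∧ k ∈ B := by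
    intro k hk
    rw [Finset.mem_Icc] at hk
    refine existsUnique_of_exists_of_unique ?_ ?_
    · rcases hX.row_or_column (k - 1) (2 * n - k) (by omega) with ⟨l, hl, x⟩ | ⟨l, hl, x⟩
      · refine ⟨{k - 1 + 1, 2 * n - l}, (hP _).2 ⟨k - 1, l, by omega, x, rfl⟩, ?_⟩
        simp only [Finset.mem_insert, Finset.mem_singleton]
        omega
      · refine ⟨{l + 1, 2 * n - (2 * n - k)}, (hP _).2 ⟨l, 2 * n - k, by omega, x, rfl⟩, ?_⟩
        simp only [Finset.mem_insert, Finset.mem_singleton]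
        omega
    · rintro B B' ⟨hB, hk1⟩ ⟨hB', hk2⟩
      obtain ⟨a, b, h, x, rfl⟩ := (hP _).1 hB
      obtain ⟨a', b', h', x', rfl⟩ := (hP _).1 hB'
      simp only [Finset.mem_insert, Finset.mem_singleton] at hk1 hk2
      obtain ⟨rfl, rfl⟩ := huniq a b a' b' h h' x x' k hk1 hk2
      rfl
  let M : Finpartition (Finset.Icc 1 (2 * n)) := Finpartition.ofExistsUnique P
    (by
      intro B hB
      obtain ⟨a, b, h, -, rfl⟩ := (hP _).1 hB
      intro k hk
      simp only [Finset.mem_insert, Finset.mem_singleton] at hk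
      rw [Finset.mem_Icc]
      omega)
    hcover
    (by
      intro h0
      obtain ⟨a, b, -, -, h⟩ := (hP _).1 h0
      exact (Finset.insert_ne_empty _ _ h.symm).elim)
  have hMP : M.parts = P := rfl
  refine ⟨M, ?_, ?_⟩
  · intro B hB
    rw [hMP] at hB
    obtain ⟨a, b, h, -, rfl⟩ := (hP _).1 hB
    rw [Finset.card_pair (by omega)]
  · intro a b hab
    rw [arcMarks_iff hab, hMP, hP]
    constructor
    · rintro ⟨a', b', h, x, e⟩
      obtain ⟨rfl, rfl⟩ := arcBlock_injective hab h e
      exact x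
    · intro x
      exact ⟨a, b, hab, x, rfl⟩

/-! ### Symmetric matchings and half walks. -/

open Classical in
/-- The bilaterally symmetric matchings on `[2m]` that admit a growth diagram of shapes with at
most three parts are equinumerous with the walks of length `m` in the chamber of partitions. -/
theorem card_symmetric_matchings_eq_card_walks (R : LocalRule) (m : ℕ)
    (P : Finpartition (Finset.Icc 1 (2 * m)) → Prop)
    (hP : ∀ M, IsMatching M → (P M ↔ ∃ F, IsGrowth R (2 * m) (arcMarks M) F)) :
    (Finset.univ.filter fun M : Finpartition (Finset.Icc 1 (2 * m)) =>
      IsMatching M ∧ IsBilaterallySymmetric M ∧ P M).card = (chamberWalks m 0).card := by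
  set S := Finset.univ.filter fun M : Finpartition (Finset.Icc 1 (2 * m)) =>
      IsMatching M ∧ IsBilaterallySymmetric M ∧ P M with hS
  have hmem : ∀ M ∈ S, IsMatching M ∧ IsBilaterallySymmetric M ∧ P M := fun M hM =>
    (Finset.mem_filter.1 hM).2
  have hex : ∀ M : Finpartition (Finset.Icc 1 (2 * m)), ∃ F, M ∈ S →
      IsGrowth R (2 * m) (arcMarks M) F := by
    intro M
    by_cases hM : M ∈ S
    · obtain ⟨F, hF⟩ := (hP M (hmem M hM).1).1 (hmem M hM).2.2
      exact ⟨F, fun _ => hF⟩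
    · exact ⟨fun _ _ => 0, fun h => absurd h hM⟩
  choose F hF using hex
  have hadj : ∀ M ∈ S, ∀ a b, a + b + 1 = 2 * m → (F M a (b + 1)).Adj (F M (a + 1) b) :=
    fun M hM a b hab => (hF M hM).adj (hmem M hM).1.isPerfect hab
  have hsym : ∀ M ∈ S, ∀ a b, a + b ≤ 2 * m → F M a b = F M b a := by
    intro M hM
    have h := (hF M hM).swap.congr (X' := arcMarks M) fun a b hab =>
      ((hmem M hM).1.isBilaterallySymmetric_iff.1 (hmem M hM).2.1 b a (by omega))
    exact (hF M hM).forward_unique h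
  -- The first half of the hypotenuse, frozen at its midpoint; symmetry of the diagram supplies the
  -- other half.
  refine Finset.card_bij (fun M _ k => F M (min k m) (2 * m - min k m)) ?_ ?_ ?_
  · intro M hM
    rw [mem_chamberWalks Shape.isPartition_zero]
    refine ⟨?_, fun k hk => ?_, fun k hk => ?_⟩
    · rw [Nat.zero_min, (hF M hM).left _ (by omega)]
    · have := hadj M hM k (2 * m - (k + 1)) (by omega)
      rw [min_eq_left hk.le, min_eq_left (show k + 1 ≤ m by omega)]
      rwa [show 2 * m - (k + 1) + 1 = 2 * m - k by omega] at this
    · rw [min_eq_right hk, min_self]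
  · intro M hM M' hM' h
    have hd : ∀ a b, a + b = 2 * m → a ≤ m → F M a b = F M' a b := by
      intro a b hab ha
      have := congrFun h a
      simp only [min_eq_left ha] at this
      rwa [show 2 * m - a = b by omega] at this
    refine (hmem M hM).1.ext_arcMarks (hmem M' hM').1
      ((hF M hM).backward_unique (hF M' hM') (hadj M hM) fun a b hab => ?_).2
    rcases le_total a m with ha | ha
    · exact hd a b hab ha
    · rw [hsym M hM a b hab.le, hsym M' hM' a b hab.le]
      exact hd b a (by omega) (by omega)
  · intro w hw
    obtain ⟨h0, h1, h2⟩ := (mem_chamberWalks Shape.isPartition_zero).1 hw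
    -- The palindromic extension ends at ∅ again, as a hypotenuse must.
    let u : ℕ → Shape := fun k => if k ≤ m then w k else w (2 * m - k)
    have hu : ∀ k < 2 * m, (u k).Adj (u (k + 1)) := by
      intro k hk
      rcases lt_or_ge k m with h | h
      · simp only [u, if_pos h.le, if_pos (show k + 1 ≤ m by omega)]
        exact h1 k h
      · have := (h1 (2 * m - (k + 1)) (by omega)).symm
        rw [show 2 * m - (k + 1) + 1 = 2 * m - k by omega] at this
        simp only [u, if_neg (show ¬ k + 1 ≤ m by omega)]
        split_ifs with hk'
        · rwa [show 2 * m - k = k by omega] at this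
        · exact this
    have hrev : ∀ a b, a + b = 2 * m → u a = u b := by
      intro a b hab
      simp only [u]
      split_ifs with h h'
      · rw [show a = b by omega]
      · congr 1; omega
      · congr 1; omega
      · omega
    have hu0 : u 0 = 0 := by simp [u, h0]
    have huN : u (2 * m) = 0 := by rw [← hrev 0 (2 * m) (by omega), hu0]
    obtain ⟨X, G, hG, hGu⟩ := exists_isGrowth R (2 * m) u hu hu0 huN
    have hGadj : ∀ a b, a + b + 1 = 2 * m → (G a (b + 1)).Adj (G (a + 1) b) := by
      intro a b hab
      rw [hGu a (b + 1) (by omega), hGu (a + 1) b (by omega)]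
      exact hu a (by omega)
    obtain ⟨M, hM, hMX⟩ := (hG.isPerfect hGadj).exists_matching
    have hGM : IsGrowth R (2 * m) (arcMarks M) G :=
      hG.congr fun a b hab => (hMX a b hab).symm
    have hMS : M ∈ S := by
      refine Finset.mem_filter.2 ⟨Finset.mem_univ _, hM, ?_, (hP M hM).2 ⟨G, hGM⟩⟩
      rw [hM.isBilaterallySymmetric_iff]
      -- The diagram and its transpose agree on the palindromic hypotenuse, so backward uniqueness
      -- makes the marks symmetric.
      exact (hGM.backward_unique hGM.swap hGadj fun a b hab => by
        rw [hGu a b hab, hGu b a (by omega), hrev a b hab]).2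
    refine ⟨M, hMS, funext fun k => ?_⟩
    rw [(hF M hMS).forward_unique hGM _ _ (by omega), hGu _ _ (by omega)]
    simp only [u, if_pos (min_le_right k m)]
    rcases le_total k m with hk | hk
    · rw [min_eq_left hk]
    · rw [min_eq_right hk, h2 k hk]

/-! ### The local rule for rows. -/

/-- The local rule at a cell for the length of the first row: `i`, `j`, `k`, `l` are the lengths
at the corners of the cell. -/
def RowRule (i j k : ℤ) (x : Prop) (l : ℤ) : Prop :=
  i ≤ j ∧ i ≤ k ∧ (x ∧ j = i ∧ k = i ∧ l = i + 1 ∨ ¬ x ∧ l = max j k)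

/-- Fomin's local rule. -/
def RowRel (μ ν ρ : Shape) (x : Prop) (r : Shape) : Prop :=
  (μ.Step ν ∧ μ.Step ρ ∧ ν.Step r ∧ ρ.Step r) ∧
    RowRule μ.1 ν.1 ρ.1 x r.1 ∧
    -- When both edges enlarge one row, a box is bumped to the next, whose "mark" is therefore the
    -- inner corner of the row above. The last clause forbids a bump into a fourth row.
    RowRule μ.2.1 ν.2.1 ρ.2.1 (μ.1 < ν.1 ∧ μ.1 < ρ.1) r.2.1 ∧
    RowRule μ.2.2 ν.2.2 ρ.2.2 (μ.2.1 < ν.2.1 ∧ μ.2.1 < ρ.2.1) r.2.2 ∧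
    ¬ (μ.2.2 < ν.2.2 ∧ μ.2.2 < ρ.2.2)

theorem RowRel.exists_backward {ν ρ r : Shape} (hν : ν.Step r) (hρ : ρ.Step r) :
    ∃ μ x, RowRel μ ν ρ x r := by
  obtain ⟨a, b, c⟩ := ν
  obtain ⟨a', b', c'⟩ := ρ
  obtain ⟨d, e, f⟩ := r
  simp only [RowRel, RowRule, Shape.Step, Shape.IsPartition] at *
  by_cases h : a = a' ∧ b = b' ∧ c = c'
  · obtain ⟨rfl, rfl, rfl⟩ := h
    by_cases h1 : a < d
    · exact ⟨(a, b, c), True, by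
        simp only [true_and, not_true, false_and, or_false]; omega⟩
    · by_cases h2 : b < e
      · exact ⟨(a - 1, b, c), False, by
          simp only [not_false_eq_true, true_and, false_and, false_or]; omega⟩
      · by_cases h3 : c < f
        · exact ⟨(a, b - 1, c), False, by
            simp only [not_false_eq_true, true_and, false_and, false_or]; omega⟩
        · exact ⟨(a, b, c), False, by
            simp only [not_false_eq_true, true_and, false_and, false_or]; omega⟩
  · exact ⟨(min a a', min b b', min c c'), False, by
      simp only [not_false_eq_true, true_and, false_and, false_or]; omega⟩

theorem RowRel.size_of_marked {μ ν ρ r : Shape} (h : RowRel μ ν ρ True r) :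
    r.size + μ.size = ν.size + ρ.size + 1 := by
  simp only [RowRel, RowRule, Shape.Step, Shape.IsPartition, Shape.size, true_and, not_true,
    false_and, or_false] at *
  omega

theorem RowRel.size_of_unmarked {μ ν ρ r : Shape} (h : RowRel μ ν ρ False r) :
    r.size + μ.size = ν.size + ρ.size := by
  simp only [RowRel, RowRule, Shape.Step, Shape.IsPartition, Shape.size, not_false_eq_true,
    true_and, false_and, false_or] at *
  omega

theorem RowRule.symm {i j k l : ℤ} {x y : Prop} (h : RowRule i j k x l) (hxy : x ↔ y) :
    RowRule i k j y l := by
  obtain ⟨h1, h2, h3⟩ := h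
  rw [max_comm, hxy] at h3
  exact ⟨h2, h1, h3.imp (fun h => ⟨h.1, h.2.2.1, h.2.1, h.2.2.2⟩) id⟩

theorem RowRel.symm {μ ν ρ r : Shape} {x : Prop} (h : RowRel μ ν ρ x r) : RowRel μ ρ ν x r :=
  ⟨⟨h.1.2.1, h.1.1, h.1.2.2.2, h.1.2.2.1⟩, h.2.1.symm Iff.rfl, h.2.2.1.symm and_comm,
    h.2.2.2.1.symm and_comm, fun h' => h.2.2.2.2 h'.symm⟩

theorem RowRel.not_marked_of_unmarked {μ μ' ν ρ r : Shape} (h : RowRel μ ν ρ True r)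
    (h' : RowRel μ' ν ρ False r) : False := by
  simp only [RowRel, RowRule, Shape.Step, Shape.IsPartition, not_false_eq_true,
    true_and, false_and, false_or, not_true, or_false] at *
  omega

theorem RowRel.eq_of_marked {μ μ' ν ρ r : Shape} (h : RowRel μ ν ρ True r)
    (h' : RowRel μ' ν ρ True r) : μ = μ' := by
  simp only [RowRel, RowRule, Shape.Step, Shape.IsPartition, true_and, not_true,
    false_and, or_false] at *
  ext <;> omega

theorem RowRel.eq_of_unmarked {μ μ' ν ρ r : Shape} (h : RowRel μ ν ρ False r)
    (h' : RowRel μ' ν ρ False r) : μ = μ' := by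
  have hs := h.size_of_unmarked
  have hs' := h'.size_of_unmarked
  simp only [RowRel, RowRule, Shape.Step, Shape.IsPartition, not_false_eq_true,
    true_and, false_and, false_or, Shape.size] at *
  ext <;> omega

theorem RowRule.unique {i j k l l' : ℤ} {x : Prop} (h : RowRule i j k x l)
    (h' : RowRule i j k x l') : l = l' := by
  rcases h.2.2 with h | h <;> rcases h'.2.2 with h' | h'
  · rw [h.2.2.2, h'.2.2.2]
  · exact absurd h.1 h'.1
  · exact absurd h'.1 h.1
  · rw [h.2, h'.2]

/-- Fomin's local rule for the row lengths of diagrams with at most three rows. -/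
def rowLocalRule : LocalRule where
  Rel := RowRel
  steps h := h.1
  size_of_marked h hx := by rw [eq_true hx] at h; exact h.size_of_marked
  size_of_unmarked h hx := by rw [eq_false hx] at h; exact h.size_of_unmarked
  symm h := h.symm
  exists_backward := RowRel.exists_backward
  backward_unique {μ μ' ν ρ r x x'} h h' := by
    by_cases hx : x <;> by_cases hx' : x'
    · rw [eq_true hx] at h; rw [eq_true hx'] at h'
      exact ⟨h.eq_of_marked h', iff_of_true hx hx'⟩
    · rw [eq_true hx] at h; rw [eq_false hx'] at h'
      exact (h.not_marked_of_unmarked h').elim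
    · rw [eq_false hx] at h; rw [eq_true hx'] at h'
      exact (h'.not_marked_of_unmarked h).elim
    · rw [eq_false hx] at h; rw [eq_false hx'] at h'
      exact ⟨h.eq_of_unmarked h', iff_of_false hx hx'⟩
  forward_unique h h' :=
    Prod.ext (h.2.1.unique h'.2.1)
      (Prod.ext (h.2.2.1.unique h'.2.2.1) (h.2.2.2.1.unique h'.2.2.2.1))

/-! ### Shadow lines and descents. -/

/-- `L` obeys the local rule of the first row on the rectangle of the cells `(a, b)` with `a < P`,
`b < Q` and the marks `x`. -/
def IsLayer (P Q : ℕ) (x : ℕ → ℕ → Prop) (L : ℕ → ℕ → ℤ) : Prop :=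
  ∀ a < P, ∀ b < Q, RowRule (L a b) (L (a + 1) b) (L a (b + 1)) (x a b) (L (a + 1) (b + 1)) ∧
    L (a + 1) b ≤ L a b + 1 ∧ L a (b + 1) ≤ L a b + 1

/-- The inner corners of the level lines of `L`. -/
def innerCorner (L : ℕ → ℕ → ℤ) (a b : ℕ) : Prop :=
  L a b < L (a + 1) b ∧ L a b < L a (b + 1)

namespace IsLayer

variable {P Q : ℕ} {x : ℕ → ℕ → Prop} {L : ℕ → ℕ → ℤ}

theorem swap (h : IsLayer P Q x L) : IsLayer Q P (fun a b => x b a) fun a b => L b a :=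
  fun a ha b hb => ⟨(h b hb a ha).1.symm Iff.rfl, (h b hb a ha).2.2, (h b hb a ha).2.1⟩

theorem le_right (h : IsLayer P Q x L) {a b : ℕ} (ha : a < P) (hb : b ≤ Q) (hQ : 0 < Q) :
    L a b ≤ L (a + 1) b := by
  cases b with
  | zero => exact (h a ha 0 hQ).1.1
  | succ b =>
    obtain ⟨⟨h1, h2, h3⟩, h4, h5⟩ := h a ha b hb
    rcases h3 with ⟨-, h3, h6, h7⟩ | ⟨-, h3⟩ <;> omega

theorem mono_right (h : IsLayer P Q x L) {a b : ℕ} (s : ℕ) (ha : a + s ≤ P) (hb : b ≤ Q)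
    (hQ : 0 < Q) : L a b ≤ L (a + s) b := by
  induction s with
  | zero => exact le_rfl
  | succ s ih => exact (ih (by omega)).trans (h.le_right (by omega) hb hQ)

theorem mono_up (h : IsLayer P Q x L) {a b : ℕ} (t : ℕ) (ha : a ≤ P) (hb : b + t ≤ Q)
    (hP : 0 < P) : L a b ≤ L a (b + t) :=
  h.swap.mono_right t hb ha hP

theorem mono (h : IsLayer P Q x L) {a b a' b' : ℕ} (haa : a ≤ a') (hbb : b ≤ b') (ha : a' ≤ P)
    (hb : b' ≤ Q) (hP : 0 < P) (hQ : 0 < Q) : L a b ≤ L a' b' := by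
  obtain ⟨s, rfl⟩ := Nat.exists_eq_add_of_le haa
  obtain ⟨t, rfl⟩ := Nat.exists_eq_add_of_le hbb
  exact (h.mono_right s ha (by omega) hQ).trans (h.mono_up t (by omega) hb hP)

/-- Along a horizontal strip without inner corners. -/
theorem eq_min_of_forall_not_innerCorner (h : IsLayer P Q x L) {a b s : ℕ} (ha : a + s ≤ P)
    (hb : b < Q) (hx : ∀ k < s, ¬ innerCorner L (a + k) b) (hs : 0 < s) :
    L a b = min (L a (b + 1)) (L (a + s) b) := by
  have h0 := h a (by omega) b hb
  induction s with
  | zero => omega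
  | succ s ih =>
    have h1 := h (a + s) (by omega) b hb
    have h2 := h.mono_right s (a := a) (b := b + 1) (by omega) (by omega) (by omega)
    have h3 := hx s (by omega)
    simp only [innerCorner] at h3
    rcases Nat.eq_zero_or_pos s with rfl | hs'
    · simp only [RowRule, add_zero, zero_add] at h1 h3 ⊢
      omega
    · have h4 := ih (by omega) (fun k hk => hx k (by omega)) hs'
      simp only [RowRule] at h1
      rw [show a + (s + 1) = a + s + 1 by ring]
      omega

/-- Along a horizontal strip without marks. -/
theorem eq_max_of_forall_not_marked (h : IsLayer P Q x L) {a b s : ℕ} (ha : a + s ≤ P)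
    (hb : b < Q) (hx : ∀ k < s, ¬ x (a + k) b) (hs : 0 < s) :
    L (a + s) (b + 1) = max (L a (b + 1)) (L (a + s) b) := by
  induction s with
  | zero => omega
  | succ s ih =>
    have h1 := (h (a + s) (by omega) b hb).1
    have h2 := (h1.2.2.resolve_left fun h' => hx s (by omega) h'.1).2
    have h3 := h1.1
    rcases Nat.eq_zero_or_pos s with rfl | hs'
    · rw [show a + (0 + 1) = a + 0 + 1 by ring, h2, max_comm]
      rfl
    · have h4 := ih (by omega) (fun k hk => hx k (by omega)) hs'
      rw [show a + (s + 1) = a + s + 1 by ring]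
      omega

/-- Between two marks in descending position there is an inner corner. -/
theorem exists_innerCorner (h : IsLayer P Q x L) {a b a' b' : ℕ} (haa : a < a') (hbb : b' < b)
    (ha : a' < P) (hb : b < Q) (hx : x a b) (hx' : x a' b') :
    ∃ c d, a < c ∧ c ≤ a' ∧ b' < d ∧ d ≤ b ∧ innerCorner L c d := by
  by_contra hno
  push Not at hno
  have e1 := h.eq_min_of_forall_not_innerCorner (a := a + 1) (b := b) (s := a' - a) (by omega) hb
    (fun k hk => hno _ _ (by omega) (by omega) hbb le_rfl) (by omega)
  have e2 := h.swap.eq_min_of_forall_not_innerCorner (a := b' + 1) (b := a') (s := b - b')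
    (by omega) ha
    (fun k hk hc => hno a' (b' + 1 + k) haa le_rfl (by omega) (by omega) ⟨hc.2, hc.1⟩) (by omega)
  rw [show a + 1 + (a' - a) = a' + 1 by omega] at e1
  simp only [show b' + 1 + (b - b') = b + 1 by omega] at e2
  obtain ⟨⟨-, -, r⟩, -⟩ := h a (by omega) b hb
  obtain ⟨⟨-, -, r'⟩, -⟩ := h a' ha b' (by omega)
  have r := r.resolve_right fun t => t.1 hx
  have r' := r'.resolve_right fun t => t.1 hx'
  -- At a mark the upper right corner exceeds both edge corners, so each minimum is attained at the
  -- far end. Monotonicity then gives the cycle L a' (b'+1) < L (a'+1) (b'+1) ≤ L (a'+1) b = L (a+1)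
  -- b < L (a+1) (b+1) ≤ L a' (b+1) = L a' (b'+1).
  have m1 := h.mono (a := a' + 1) (a' := a' + 1) (b := b' + 1) (b' := b) le_rfl hbb ha hb.le
    (by omega) (by omega)
  have m2 := h.mono (a := a + 1) (a' := a') (b := b + 1) (b' := b + 1) haa le_rfl ha.le hb
    (by omega) (by omega)
  omega

/-- Between two inner corners in descending position there is a mark. -/
theorem exists_marked (h : IsLayer P Q x L) {a b a' b' : ℕ} (haa : a < a') (hbb : b' < b)
    (ha : a' < P) (hb : b < Q) (hx : innerCorner L a b) (hx' : innerCorner L a' b') :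
    ∃ c d, a ≤ c ∧ c < a' ∧ b' ≤ d ∧ d < b ∧ x c d := by
  by_contra hno
  push Not at hno
  have e1 := h.swap.eq_max_of_forall_not_marked (a := b') (b := a) (s := b - b') (by omega)
    (by omega) (fun k hk => hno _ _ le_rfl haa (by omega) (by omega)) (by omega)
  have e2 := h.eq_max_of_forall_not_marked (a := a) (b := b') (s := a' - a) (by omega)
    (by omega) (fun k hk => hno _ _ (by omega) (by omega) le_rfl hbb) (by omega)
  simp only [show b' + (b - b') = b by omega] at e1
  rw [show a + (a' - a) = a' by omega] at e2
  simp only [innerCorner] at hx hx'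
  -- Dually, the corners force both maxima to the far end: L a b < L (a+1) b = L (a+1) b' ≤ L a' b'
  -- < L a' (b'+1) = L a (b'+1) ≤ L a b.
  have m1 := h.mono (a := a + 1) (a' := a') (b := b') (b' := b') haa le_rfl ha.le (by omega)
    (by omega) (by omega)
  have m2 := h.mono (a := a) (a' := a) (b := b' + 1) (b' := b) le_rfl hbb (by omega) hb.le
    (by omega) (by omega)
  omega

theorem exists_marked_left (h : IsLayer P Q x L) (h0 : ∀ b ≤ Q, L 0 b = 0) {a b : ℕ} (ha : a < P)
    (hb : b < Q) (hx : innerCorner L a b) : ∃ c < a, x c b := by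
  by_contra hno
  push Not at hno
  have h1 := h0 b hb.le
  have h2 := h0 (b + 1) hb
  rcases Nat.eq_zero_or_pos a with rfl | ha0
  · simp only [innerCorner] at hx
    omega
  · have e := h.eq_max_of_forall_not_marked (a := 0) (b := b) (s := a) (by omega) hb
      (fun k hk => by rw [zero_add]; exact hno k hk) ha0
    have m := h.mono (a := 0) (a' := a) (b := b) (b' := b) (by omega) le_rfl ha.le hb.le
      (by omega) (by omega)
    rw [zero_add] at e
    simp only [innerCorner] at hx
    omega

end IsLayer

/-- There are `k` marks in the rectangle with increasing first and decreasing second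
coordinates. -/
def HasDescent (P Q : ℕ) (x : ℕ → ℕ → Prop) (k : ℕ) : Prop :=
  ∃ a b : ℕ → ℕ, (∀ i < k, a i < P ∧ b i < Q ∧ x (a i) (b i)) ∧
    ∀ i, i + 1 < k → a i < a (i + 1) ∧ b (i + 1) < b i

theorem IsLayer.hasDescent_innerCorner {P Q : ℕ} {x : ℕ → ℕ → Prop} {L : ℕ → ℕ → ℤ}
    (h : IsLayer P Q x L) {k : ℕ} (hd : HasDescent P Q x (k + 1)) :
    HasDescent P Q (innerCorner L) k := by
  obtain ⟨a, b, hx, hab⟩ := hd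
  have hex : ∀ i, ∃ c d, i < k → a i < c ∧ c ≤ a (i + 1) ∧ b (i + 1) < d ∧ d ≤ b i ∧
      innerCorner L c d := by
    intro i
    by_cases hi : i < k
    · obtain ⟨c, d, hcd⟩ := h.exists_innerCorner (hab i (by omega)).1 (hab i (by omega)).2
        (hx (i + 1) (by omega)).1 (hx i (by omega)).2.1 (hx i (by omega)).2.2
        (hx (i + 1) (by omega)).2.2
      exact ⟨c, d, fun _ => hcd⟩
    · exact ⟨0, 0, fun h => absurd h hi⟩
  choose c d hcd using hex
  refine ⟨c, d, fun i hi => ?_, fun i hi => ?_⟩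
  · have h1 := hcd i hi
    have h2 := hx (i + 1) (by omega)
    have h3 := hx i (by omega)
    exact ⟨by omega, by omega, h1.2.2.2.2⟩
  · have h1 := hcd i (by omega)
    have h2 := hcd (i + 1) (by omega)
    exact ⟨by omega, by omega⟩

/-- Marks interlace with the corners: one lies between each two consecutive corners, and the zero
boundary supplies one more beyond each end, so k corners yield k + 1 marks. -/
theorem IsLayer.hasDescent_of_innerCorner {P Q : ℕ} {x : ℕ → ℕ → Prop} {L : ℕ → ℕ → ℤ}
    (h : IsLayer P Q x L) (hl : ∀ b ≤ Q, L 0 b = 0) (hb : ∀ a ≤ P, L a 0 = 0) {k : ℕ} (hk : 0 < k)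
    (hd : HasDescent P Q (innerCorner L) k) : HasDescent P Q x (k + 1) := by
  obtain ⟨a, b, hx, hab⟩ := hd
  have hex : ∀ i, ∃ c d, i ≤ k → (0 < i → a (i - 1) ≤ c ∧ d < b (i - 1)) ∧
      (i < k → c < a i ∧ b i ≤ d) ∧ (i = 0 → d = b 0) ∧ (i = k → c = a (k - 1)) ∧ x c d := by
    intro i
    rcases Nat.eq_zero_or_pos i with rfl | hi
    · obtain ⟨c, hc, hcx⟩ := h.exists_marked_left hl (hx 0 hk).1 (hx 0 hk).2.1 (hx 0 hk).2.2
      exact ⟨c, b 0, fun _ => ⟨fun h => by omega, fun _ => ⟨hc, le_rfl⟩, fun _ => rfl,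
        fun h => by omega, hcx⟩⟩
    · rcases lt_trichotomy i k with hik | rfl | hik
      · have h1 := hab (i - 1) (by omega)
        have h2 := hx (i - 1) (by omega)
        have h3 := hx i hik
        rw [Nat.sub_add_cancel hi] at h1
        obtain ⟨c, d, h4⟩ := h.exists_marked h1.1 h1.2 h3.1 h2.2.1 h2.2.2 h3.2.2
        exact ⟨c, d, fun _ => ⟨fun _ => by omega, fun _ => by omega, fun h => by omega,
          fun h => by omega, h4.2.2.2.2⟩⟩
      · have h2 := hx (i - 1) (by omega)
        obtain ⟨d, hd, hdx⟩ := h.swap.exists_marked_left hb h2.2.1 h2.1 ⟨h2.2.2.2, h2.2.2.1⟩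
        exact ⟨a (i - 1), d, fun _ => ⟨fun _ => ⟨le_rfl, hd⟩, fun h => by omega,
          fun h => by omega, fun _ => rfl, hdx⟩⟩
      · exact ⟨0, 0, fun h => by omega⟩
  choose c d hcd using hex
  refine ⟨c, d, fun i hi => ?_, fun i hi => ?_⟩
  · obtain ⟨h1, h2, h3, h4, h5⟩ := hcd i (by omega)
    refine ⟨?_, ?_, h5⟩
    · rcases Nat.lt_succ_iff_lt_or_eq.1 hi with hi | hi
      · exact (h2 hi).1.trans (hx i hi).1
      · rw [h4 hi]
        exact (hx (k - 1) (by omega)).1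
    · rcases Nat.eq_zero_or_pos i with hi' | hi'
      · rw [h3 hi']
        exact (hx 0 hk).2.1
      · exact (h1 hi').2.trans (hx (i - 1) (by omega)).2.1
  · have h1 := (hcd i (by omega)).2.1 (by omega)
    have h2 := (hcd (i + 1) (by omega)).1 (by omega)
    rw [Nat.add_sub_cancel] at h2
    exact ⟨by omega, by omega⟩

theorem Shape.Step.le_add_one {u v : Shape} (h : u.Step v) :
    v.1 ≤ u.1 + 1 ∧ v.2.1 ≤ u.2.1 + 1 ∧ v.2.2 ≤ u.2.2 + 1 := by
  simp only [Step] at h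
  omega

/-- The first three rows of a cell of a growth diagram. -/
def RowRules (μ ν ρ : Shape) (x : Prop) (r : Shape) : Prop :=
  (μ.Step ν ∧ μ.Step ρ) ∧ RowRule μ.1 ν.1 ρ.1 x r.1 ∧
    RowRule μ.2.1 ν.2.1 ρ.2.1 (μ.1 < ν.1 ∧ μ.1 < ρ.1) r.2.1 ∧
    RowRule μ.2.2 ν.2.2 ρ.2.2 (μ.2.1 < ν.2.1 ∧ μ.2.1 < ρ.2.1) r.2.2

/-- Viennot's shadow lines: the third row has an inner corner if and only if the marks contain
a descent of length four. -/
theorem exists_innerCorner_iff_hasDescent {P Q : ℕ} {X : ℕ → ℕ → Prop} {F : ℕ → ℕ → Shape}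
    (h : ∀ a < P, ∀ b < Q, RowRules (F a b) (F (a + 1) b) (F a (b + 1)) (X a b)
      (F (a + 1) (b + 1)))
    (hl : ∀ b ≤ Q, F 0 b = 0) (hb : ∀ a ≤ P, F a 0 = 0) :
    (∃ a < P, ∃ b < Q, innerCorner (fun a b => (F a b).2.2) a b) ↔ HasDescent P Q X 4 := by
  have l1 : IsLayer P Q X fun a b => (F a b).1 := fun a ha b hb =>
    ⟨(h a ha b hb).2.1, (h a ha b hb).1.1.le_add_one.1, (h a ha b hb).1.2.le_add_one.1⟩
  have l2 : IsLayer P Q (innerCorner fun a b => (F a b).1) fun a b => (F a b).2.1 :=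
    fun a ha b hb =>
    ⟨(h a ha b hb).2.2.1, (h a ha b hb).1.1.le_add_one.2.1, (h a ha b hb).1.2.le_add_one.2.1⟩
  have l3 : IsLayer P Q (innerCorner fun a b => (F a b).2.1) fun a b => (F a b).2.2 :=
    fun a ha b hb =>
    ⟨(h a ha b hb).2.2.2, (h a ha b hb).1.1.le_add_one.2.2, (h a ha b hb).1.2.le_add_one.2.2⟩
  constructor
  · rintro ⟨a, ha, b, hb', hc⟩
    have d1 : HasDescent P Q (innerCorner fun a b => (F a b).2.2) 1 :=
      ⟨fun _ => a, fun _ => b, fun _ _ => ⟨ha, hb', hc⟩, fun i hi => by omega⟩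
    have d2 := l3.hasDescent_of_innerCorner (fun b hb => by rw [hl b hb]; rfl)
      (fun a ha => by rw [hb a ha]; rfl) one_pos d1
    have d3 := l2.hasDescent_of_innerCorner (fun b hb => by rw [hl b hb]; rfl)
      (fun a ha => by rw [hb a ha]; rfl) two_pos d2
    exact l1.hasDescent_of_innerCorner (fun b hb => by rw [hl b hb]; rfl)
      (fun a ha => by rw [hb a ha]; rfl) three_pos d3
  · intro d
    obtain ⟨a, b, hab, -⟩ := l3.hasDescent_innerCorner (l2.hasDescent_innerCorner
      (l1.hasDescent_innerCorner d))
    exact ⟨a 0, (hab 0 one_pos).1, b 0, (hab 0 one_pos).2.1, (hab 0 one_pos).2.2⟩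

/-! ### Forward growth and the row criterion. -/

/-- The growth diagram with the marks `X` and the forward rule `f`. -/
def forwardGrowth (f : Shape → Shape → Shape → Prop → Shape) (X : ℕ → ℕ → Prop) :
    ℕ → ℕ → Shape
  | 0, _ => 0
  | _ + 1, 0 => 0
  | a + 1, b + 1 => f (forwardGrowth f X a b) (forwardGrowth f X (a + 1) b)
      (forwardGrowth f X a (b + 1)) (X a b)

theorem forwardGrowth_zero_left (f : Shape → Shape → Shape → Prop → Shape) (X : ℕ → ℕ → Prop)
    (b : ℕ) : forwardGrowth f X 0 b = 0 := by
  rw [forwardGrowth]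

theorem forwardGrowth_zero_right (f : Shape → Shape → Shape → Prop → Shape) (X : ℕ → ℕ → Prop)
    (a : ℕ) : forwardGrowth f X a 0 = 0 := by
  cases a <;> rw [forwardGrowth]

/-- A mark is alone in its row and column, so no earlier mark enlarges the two edges at its cell.
This is the precondition of the marked case of either forward rule. -/
theorem IsGrowth.eq_of_marked {R : LocalRule} {N n : ℕ} {X : ℕ → ℕ → Prop} {F : ℕ → ℕ → Shape}
    (h : IsGrowth R n X F) (hX : IsPerfect N X) (hn : n + 1 ≤ N) {a b : ℕ} (hab : a + b + 1 = n)
    (hx : X a b) : F a b = F (a + 1) b ∧ F a b = F a (b + 1) := by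
  constructor
  · refine (h.step_right hab.le).eq_of_size ?_
    rcases (h.row_marks hab.le).1 with h' | ⟨-, k, hk, hk'⟩
    · exact h'.1.symm
    · have := hX.row_unique a (N - 1 - a) (by omega) k (by omega) b (by omega) hk' hx
      omega
  · refine (h.step_up hab.le).eq_of_size ?_
    rcases (h.column_marks hab.le).1 with h' | ⟨-, k, hk, hk'⟩
    · exact h'.1.symm
    · have := hX.column_unique (N - 1 - b) b (by omega) k (by omega) a (by omega) hk' hx
      omega

theorem IsGrowth.of_extension {R : LocalRule} {N : ℕ} {X : ℕ → ℕ → Prop} {F : ℕ → ℕ → Shape}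
    (hl : ∀ b, F 0 b = 0) (hb : ∀ a, F a 0 = 0)
    (h : ∀ n a b, n + 1 ≤ N → a + b + 1 = n → IsGrowth R n X F →
      R.Rel (F a b) (F (a + 1) b) (F a (b + 1)) (X a b) (F (a + 1) (b + 1))) :
    IsGrowth R N X F := by
  have key : ∀ n ≤ N, IsGrowth R n X F := by
    intro n
    induction n with
    | zero => exact fun _ => ⟨fun b _ => hl b, fun a _ => hb a, fun a b hab => by omega⟩
    | succ n ih =>
      intro hn
      have hg := ih (by omega)
      refine ⟨fun b _ => hl b, fun a _ => hb a, fun a b hab => ?_⟩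
      rcases Nat.lt_or_ge n (a + b + 2) with h' | h'
      · exact h n a b hn (by omega) hg
      · exact hg.cell a b h'
  exact key N le_rfl

open Classical in
/-- The forward version of Fomin's local rule. -/
noncomputable def rowForward (μ ν ρ : Shape) (x : Prop) : Shape :=
  (if x then μ.1 + 1 else max ν.1 ρ.1,
    if μ.1 < ν.1 ∧ μ.1 < ρ.1 then μ.2.1 + 1 else max ν.2.1 ρ.2.1,
    if μ.2.1 < ν.2.1 ∧ μ.2.1 < ρ.2.1 then μ.2.2 + 1 else max ν.2.2 ρ.2.2)

theorem rowRules_rowForward {μ ν ρ : Shape} {x : Prop} (hν : μ.Step ν) (hρ : μ.Step ρ)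
    (hx : x → μ = ν ∧ μ = ρ) : RowRules μ ν ρ x (rowForward μ ν ρ x) := by
  refine ⟨⟨hν, hρ⟩, ⟨hν.2.2.1, hρ.2.2.1, ?_⟩, ⟨hν.2.2.2.1, hρ.2.2.2.1, ?_⟩,
    hν.2.2.2.2.1, hρ.2.2.2.2.1, ?_⟩
  · by_cases h : x
    · exact Or.inl ⟨h, by rw [← (hx h).1], by rw [← (hx h).2], if_pos h⟩
    · exact Or.inr ⟨h, if_neg h⟩
  · simp only [Shape.Step] at hν hρ
    by_cases h : μ.1 < ν.1 ∧ μ.1 < ρ.1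
    · exact Or.inl ⟨h, by omega, by omega, if_pos h⟩
    · exact Or.inr ⟨h, if_neg h⟩
  · simp only [Shape.Step] at hν hρ
    by_cases h : μ.2.1 < ν.2.1 ∧ μ.2.1 < ρ.2.1
    · exact Or.inl ⟨h, by omega, by omega, if_pos h⟩
    · exact Or.inr ⟨h, if_neg h⟩

theorem RowRules.rowRel {μ ν ρ r : Shape} {x : Prop} (h : RowRules μ ν ρ x r)
    (hx : x → μ = ν ∧ μ = ρ) (hc : ¬ (μ.2.2 < ν.2.2 ∧ μ.2.2 < ρ.2.2)) : RowRel μ ν ρ x r := by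
  refine ⟨⟨h.1.1, h.1.2, ?_⟩, h.2.1, h.2.2.1, h.2.2.2, hc⟩
  by_cases h' : x
  · obtain ⟨rfl, rfl⟩ := hx h'
    simp only [RowRules, RowRule, Shape.Step, Shape.IsPartition, h', not_true, true_and,
      false_and, or_false] at *
    omega
  · simp only [RowRules, RowRule, Shape.Step, Shape.IsPartition, h', true_and,
      false_and, false_or, not_false_eq_true] at *
    omega

theorem RowRel.rowRules {μ ν ρ r : Shape} {x : Prop} (h : RowRel μ ν ρ x r) :
    RowRules μ ν ρ x r :=
  ⟨⟨h.1.1, h.1.2.1⟩, h.2.1, h.2.2.1, h.2.2.2.1⟩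

/-- Forward growth breaks down only where a box would be bumped out of the third row, at an inner
corner of that row; shadow lines turn this into a descent of four marks. -/
theorem exists_isGrowth_rowLocalRule_iff {N : ℕ} {X : ℕ → ℕ → Prop} (hX : IsPerfect N X) :
    (∃ F, IsGrowth rowLocalRule N X F) ↔ ¬ ∃ P Q, P + Q ≤ N ∧ HasDescent P Q X 4 := by
  constructor
  · rintro ⟨F, hF⟩ ⟨P, Q, hPQ, hd⟩
    have hc : ∀ a < P, ∀ b < Q, RowRel (F a b) (F (a + 1) b) (F a (b + 1)) (X a b)
      (F (a + 1) (b + 1)) := fun a ha b hb => hF.cell a b (by omega)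
    obtain ⟨a, ha, b, hb, h⟩ := (exists_innerCorner_iff_hasDescent
      (fun a ha b hb => (hc a ha b hb).rowRules) (fun b hb => hF.left b (by omega))
      (fun a ha => hF.bottom a (by omega))).2 hd
    exact (hc a ha b hb).2.2.2.2 h
  · intro hno
    have hl := forwardGrowth_zero_left rowForward X
    have hb := forwardGrowth_zero_right rowForward X
    have hs : ∀ a b, forwardGrowth rowForward X (a + 1) (b + 1) =
        rowForward (forwardGrowth rowForward X a b) (forwardGrowth rowForward X (a + 1) b)
          (forwardGrowth rowForward X a (b + 1)) (X a b) := fun a b => by rw [forwardGrowth]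
    refine ⟨forwardGrowth rowForward X, IsGrowth.of_extension hl hb fun n a b hn hab hg => ?_⟩
    set F := forwardGrowth rowForward X
    have hr := rowRules_rowForward (x := X a b) (hg.step_right hab.le) (hg.step_up hab.le)
      (hg.eq_of_marked hX hn hab)
    rw [← hs] at hr
    refine hr.rowRel (hg.eq_of_marked hX hn hab) fun hc => hno ⟨a + 1, b + 1, by omega, ?_⟩
    refine (exists_innerCorner_iff_hasDescent (fun a' ha' b' hb' => ?_) (fun b _ => hl b)
      (fun a _ => hb a)).1 ⟨a, by omega, b, by omega, hc⟩
    -- All cells of the rectangle but its last lie in the smaller triangle; `hr` covers the last.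
    rcases Nat.lt_or_ge n (a' + b' + 2) with h | h
    · obtain rfl : a' = a := by omega
      obtain rfl : b' = b := by omega
      exact hr
    · exact RowRel.rowRules (hg.cell a' b' h)

/-! ### The local rule for columns. -/

/-- The row of the box in which `v` differs from `u`, in terms of column lengths. -/
def Shape.boxRow (u v : Shape) : ℤ :=
  if u.1 < v.1 then v.1 else if u.2.1 < v.2.1 then v.2.1 else v.2.2

theorem Shape.Step.eq_of_boxRow_eq {u v v' : Shape} (h : u.Step v) (h' : u.Step v')
    (hs : v.size = u.size + 1) (hs' : v'.size = u.size + 1) (hr : u.boxRow v = u.boxRow v') :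
    v = v' := by
  simp only [Step, IsPartition, size, boxRow] at *
  ext <;> split_ifs at hr <;> omega

theorem Shape.Step.eq_of_boxRow_eq' {u u' v : Shape} (h : u.Step v) (h' : u'.Step v)
    (hs : v.size = u.size + 1) (hs' : v.size = u'.size + 1) (hr : u.boxRow v = u'.boxRow v) :
    u = u' := by
  simp only [Step, IsPartition, size, boxRow] at *
  ext <;> split_ifs at hr <;> omega

/-- Reverse bumping. If the new box lies in row t ≠ 1, some column of v has length t − 1, and the
rightmost such column can lose its last box. -/
theorem Shape.Step.exists_lower {v w : Shape} (h : v.Step w) (hs : w.size = v.size + 1)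
    (hr : v.boxRow w ≠ 1) :
    ∃ u : Shape, u.Step v ∧ v.size = u.size + 1 ∧ v.boxRow w = u.boxRow v + 1 := by
  obtain ⟨a, b, c⟩ := v
  obtain ⟨d, e, f⟩ := w
  obtain ⟨t, ht⟩ : ∃ t, t = Shape.boxRow (a, b, c) (d, e, f) := ⟨_, rfl⟩
  rw [← ht] at hr ⊢
  have ht' : t = a + 1 ∧ d = a + 1 ∧ b = e ∧ c = f ∨ t = b + 1 ∧ d = a ∧ e = b + 1 ∧ c = f ∨
      t = c + 1 ∧ d = a ∧ e = b ∧ f = c + 1 := by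
    simp only [Step, IsPartition, size, boxRow] at *
    split_ifs at ht <;> omega
  clear ht
  simp only [Step, IsPartition, size, boxRow] at *
  by_cases h2 : c = t - 1
  · refine ⟨(a, b, c - 1), ?_, ?_, ?_⟩
    · dsimp only; omega
    · dsimp only; omega
    · dsimp only; split_ifs <;> omega
  · by_cases h3 : b = t - 1
    · refine ⟨(a, b - 1, c), ?_, ?_, ?_⟩
      · dsimp only; omega
      · dsimp only; omega
      · dsimp only; split_ifs <;> omega
    · refine ⟨(a - 1, b, c), ?_, ?_, ?_⟩
      · dsimp only; omega
      · dsimp only; omega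
      · dsimp only; split_ifs <;> omega

/-- Bumping: the leftmost column of length t can take a box in row t + 1. No new column is opened,
so three columns always suffice here. -/
theorem Shape.Step.exists_upper {u v : Shape} (h : u.Step v) (hs : v.size = u.size + 1) :
    ∃ w : Shape, v.Step w ∧ w.size = v.size + 1 ∧ v.boxRow w = u.boxRow v + 1 := by
  obtain ⟨a, b, c⟩ := v
  obtain ⟨d, e, f⟩ := u
  obtain ⟨t, ht⟩ : ∃ t, t = Shape.boxRow (d, e, f) (a, b, c) := ⟨_, rfl⟩
  rw [← ht]
  have ht' : t = a ∧ a = d + 1 ∧ b = e ∧ c = f ∨ t = b ∧ d = a ∧ b = e + 1 ∧ c = f ∨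
      t = c ∧ d = a ∧ e = b ∧ c = f + 1 := by
    simp only [Step, IsPartition, size, boxRow] at *
    split_ifs at ht <;> omega
  clear ht
  simp only [Step, IsPartition, size, boxRow] at *
  by_cases h2 : a = t
  · refine ⟨(a + 1, b, c), ?_, ?_, ?_⟩
    · dsimp only; omega
    · dsimp only; omega
    · dsimp only; split_ifs <;> omega
  · by_cases h3 : b = t
    · refine ⟨(a, b + 1, c), ?_, ?_, ?_⟩
      · dsimp only; omega
      · dsimp only; omega
      · dsimp only; split_ifs <;> omega
    · refine ⟨(a, b, c + 1), ?_, ?_, ?_⟩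
      · dsimp only; omega
      · dsimp only; omega
      · dsimp only; split_ifs <;> omega

/-- The componentwise minimum. -/
def Shape.inf (u v : Shape) : Shape := (min u.1 v.1, min u.2.1 v.2.1, min u.2.2 v.2.2)

/-- The componentwise maximum. -/
def Shape.sup (u v : Shape) : Shape := (max u.1 v.1, max u.2.1 v.2.1, max u.2.2 v.2.2)

theorem Shape.ne_iff {u v : Shape} :
    u ≠ v ↔ u.1 ≠ v.1 ∨ u.2.1 ≠ v.2.1 ∨ u.2.2 ≠ v.2.2 := by
  rw [ne_eq, Prod.ext_iff, Prod.ext_iff]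
  omega

theorem Shape.eq_inf_of_steps {μ ν ρ r : Shape} (h1 : μ.Step ν) (h2 : μ.Step ρ) (h3 : ν.Step r)
    (h4 : ρ.Step r) (hne : ν ≠ ρ) : μ = ν.inf ρ := by
  rw [ne_iff] at hne
  simp only [Step, IsPartition, inf] at *
  ext <;> dsimp only <;> omega

theorem Shape.eq_sup_of_steps {μ ν ρ r : Shape} (h1 : μ.Step ν) (h2 : μ.Step ρ) (h3 : ν.Step r)
    (h4 : ρ.Step r) (hne : ν ≠ ρ) : r = ν.sup ρ := by
  rw [ne_iff] at hne
  simp only [Step, IsPartition, sup] at *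
  ext <;> dsimp only <;> omega

theorem Shape.size_inf_add_size_sup (u v : Shape) :
    (u.sup v).size + (u.inf v).size = u.size + v.size := by
  simp only [size, sup, inf]
  omega

theorem Shape.inf_step {ν ρ r : Shape} (h1 : ν.Step r) (h2 : ρ.Step r) :
    (ν.inf ρ).Step ν ∧ (ν.inf ρ).Step ρ := by
  simp only [Step, IsPartition, inf] at *
  omega

theorem Shape.step_sup {μ ν ρ : Shape} (h1 : μ.Step ν) (h2 : μ.Step ρ) :
    ν.Step (ν.sup ρ) ∧ ρ.Step (ν.sup ρ) := by
  simp only [Step, IsPartition, sup] at *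
  omega

/-- Fomin's local rule in terms of column lengths. -/
def ColumnRel (μ ν ρ : Shape) (x : Prop) (r : Shape) : Prop :=
  (μ.Step ν ∧ μ.Step ρ ∧ ν.Step r ∧ ρ.Step r) ∧
    (¬ x ∧ ν ≠ ρ ∨ ¬ x ∧ ν = ρ ∧ μ = ν ∧ r = ν ∨
      x ∧ ν = ρ ∧ μ = ν ∧ r.size = ν.size + 1 ∧ ν.boxRow r = 1 ∨
      ¬ x ∧ ν = ρ ∧ ν.size = μ.size + 1 ∧ r.size = ν.size + 1 ∧ ν.boxRow r = μ.boxRow ν + 1)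

theorem Shape.Step.boxRow_pos {u v : Shape} (h : u.Step v) (hs : v.size = u.size + 1) :
    0 < u.boxRow v := by
  simp only [Step, IsPartition, size, boxRow] at *
  split_ifs <;> omega

namespace ColumnRel

variable {μ μ' ν ρ r r' : Shape} {x x' : Prop}

theorem exists_backward (hν : ν.Step r) (hρ : ρ.Step r) : ∃ μ x, ColumnRel μ ν ρ x r := by
  by_cases h : ν = ρ
  · subst h
    have hs := hν.size_le
    by_cases h0 : ν.size = r.size
    · have e := hν.eq_of_size h0
      exact ⟨ν, False, ⟨Shape.step_refl hν.1, Shape.step_refl hν.1, hν, hν⟩,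
        Or.inr (Or.inl ⟨id, rfl, rfl, e.symm⟩)⟩
    · have h1 : r.size = ν.size + 1 := by omega
      by_cases h2 : ν.boxRow r = 1
      · exact ⟨ν, True, ⟨Shape.step_refl hν.1, Shape.step_refl hν.1, hν, hν⟩,
          Or.inr (Or.inr (Or.inl ⟨trivial, rfl, rfl, h1, h2⟩))⟩
      · obtain ⟨u, hu, hs, hr⟩ := hν.exists_lower h1 h2
        exact ⟨u, False, ⟨hu, hu, hν, hν⟩, Or.inr (Or.inr (Or.inr ⟨id, rfl, hs, h1, hr⟩))⟩
  · have hi := Shape.inf_step hν hρ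
    exact ⟨ν.inf ρ, False, ⟨hi.1, hi.2, hν, hρ⟩, Or.inl ⟨id, h⟩⟩

theorem size_of_marked (h : ColumnRel μ ν ρ x r) (hx : x) :
    r.size + μ.size = ν.size + ρ.size + 1 := by
  rcases h.2 with h | h | ⟨-, rfl, rfl, h, -⟩ | h
  · exact absurd hx h.1
  · exact absurd hx h.1
  · omega
  · exact absurd hx h.1

theorem size_of_unmarked (h : ColumnRel μ ν ρ x r) (hx : ¬ x) :
    r.size + μ.size = ν.size + ρ.size := by
  obtain ⟨⟨h1, h2, h3, h4⟩, h⟩ := h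
  rcases h with ⟨-, h⟩ | ⟨-, rfl, rfl, rfl⟩ | h | ⟨-, rfl, h5, h6, -⟩
  · rw [Shape.eq_inf_of_steps h1 h2 h3 h4 h, Shape.eq_sup_of_steps h1 h2 h3 h4 h,
      Shape.size_inf_add_size_sup]
  · rfl
  · exact absurd h.1 hx
  · omega

theorem symm (h : ColumnRel μ ν ρ x r) : ColumnRel μ ρ ν x r := by
  by_cases hne : ν = ρ
  · subst hne
    exact h
  · obtain ⟨⟨h1, h2, h3, h4⟩, h⟩ := h
    refine ⟨⟨h2, h1, h4, h3⟩, Or.inl ?_⟩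
    rcases h with h | h | h | h
    · exact ⟨h.1, Ne.symm hne⟩
    · exact absurd h.2.1 hne
    · exact absurd h.2.1 hne
    · exact absurd h.2.1 hne

theorem backward_unique (h : ColumnRel μ ν ρ x r) (h' : ColumnRel μ' ν ρ x' r) :
    μ = μ' ∧ (x ↔ x') := by
  obtain ⟨⟨h1, h2, h3, h4⟩, h⟩ := h
  obtain ⟨⟨k1, k2, k3, k4⟩, k⟩ := h'
  rcases h with ⟨hx, h⟩ | ⟨hx, h⟩ | ⟨hx, h⟩ | ⟨hx, h⟩ <;>
    rcases k with ⟨kx, k⟩ | ⟨kx, k⟩ | ⟨kx, k⟩ | ⟨kx, k⟩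
  · exact ⟨by rw [Shape.eq_inf_of_steps h1 h2 h3 h4 h, Shape.eq_inf_of_steps k1 k2 k3 k4 h],
      iff_of_false hx kx⟩
  · exact absurd k.1 h
  · exact absurd k.1 h
  · exact absurd k.1 h
  · exact absurd h.1 k
  · exact ⟨h.2.1.trans k.2.1.symm, iff_of_false hx kx⟩
  · have := congrArg Shape.size h.2.2
    omega
  · have := congrArg Shape.size h.2.2
    omega
  · exact absurd h.1 k
  · have := congrArg Shape.size k.2.2
    omega
  · exact ⟨h.2.1.trans k.2.1.symm, iff_of_true hx kx⟩
  · have := k1.boxRow_pos k.2.1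
    omega
  · exact absurd h.1 k
  · have := congrArg Shape.size k.2.2
    omega
  · have := h1.boxRow_pos h.2.1
    omega
  · exact ⟨h1.eq_of_boxRow_eq' k1 h.2.1 k.2.1 (by omega), iff_of_false hx kx⟩

theorem forward_unique (h : ColumnRel μ ν ρ x r) (h' : ColumnRel μ ν ρ x r') : r = r' := by
  obtain ⟨⟨h1, h2, h3, h4⟩, h⟩ := h
  obtain ⟨⟨-, -, k3, k4⟩, k⟩ := h'
  rcases h with ⟨hx, h⟩ | ⟨hx, h⟩ | ⟨hx, h⟩ | ⟨hx, h⟩ <;>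
    rcases k with ⟨kx, k⟩ | ⟨kx, k⟩ | ⟨kx, k⟩ | ⟨kx, k⟩
  · rw [Shape.eq_sup_of_steps h1 h2 h3 h4 h, Shape.eq_sup_of_steps h1 h2 k3 k4 h]
  · exact absurd k.1 h
  · exact absurd k.1 h
  · exact absurd k.1 h
  · exact absurd h.1 k
  · exact h.2.2.trans k.2.2.symm
  · exact absurd kx hx
  · have := congrArg Shape.size h.2.1
    omega
  · exact absurd h.1 k
  · exact absurd hx kx
  · exact h3.eq_of_boxRow_eq k3 h.2.2.1 k.2.2.1 (by omega)
  · exact absurd hx kx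
  · exact absurd h.1 k
  · have := congrArg Shape.size k.2.1
    omega
  · exact absurd kx hx
  · exact h3.eq_of_boxRow_eq k3 h.2.2.1 k.2.2.1 (by omega)

/-- Only a mark opens a new column, by a box in the first row; hence the demand that the third
column be empty. The box goes to the first empty column. -/
theorem exists_forward (hν : μ.Step ν) (hρ : μ.Step ρ) (hx : x → μ = ν ∧ μ = ρ ∧ μ.2.2 = 0) :
    ∃ r, ColumnRel μ ν ρ x r := by
  by_cases h : x
  · obtain ⟨rfl, rfl, h0⟩ := hx h
    obtain ⟨a, b, c⟩ := μ
    dsimp only at h0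
    subst h0
    have key : ∃ r : Shape, Shape.Step (a, b, 0) r ∧ r.size = Shape.size (a, b, 0) + 1 ∧
        Shape.boxRow (a, b, 0) r = 1 := by
      simp only [Shape.Step, Shape.IsPartition, Shape.size, Shape.boxRow] at *
      by_cases ha : a = 0
      · refine ⟨(a + 1, b, 0), ?_, ?_, ?_⟩
        · dsimp only; omega
        · dsimp only; omega
        · dsimp only; split_ifs <;> omega
      · by_cases hb : b = 0
        · refine ⟨(a, b + 1, 0), ?_, ?_, ?_⟩
          · dsimp only; omega
          · dsimp only; omega
          · dsimp only; split_ifs <;> omega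
        · refine ⟨(a, b, 1), ?_, ?_, ?_⟩
          · dsimp only; omega
          · dsimp only; omega
          · dsimp only; split_ifs <;> omega
    obtain ⟨r, h1, h2, h3⟩ := key
    exact ⟨r, ⟨hν, hν, h1, h1⟩, Or.inr (Or.inr (Or.inl ⟨h, rfl, rfl, h2, h3⟩))⟩
  · by_cases hne : ν = ρ
    · subst hne
      have hs := hν.size_le
      by_cases h0 : μ.size = ν.size
      · have e := hν.eq_of_size h0
        exact ⟨ν, ⟨hν, hν, Shape.step_refl hν.2.1, Shape.step_refl hν.2.1⟩,
          Or.inr (Or.inl ⟨h, rfl, e, rfl⟩)⟩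
      · have h1 : ν.size = μ.size + 1 := by omega
        obtain ⟨r, h2, h3, h4⟩ := hν.exists_upper h1
        exact ⟨r, ⟨hν, hν, h2, h2⟩, Or.inr (Or.inr (Or.inr ⟨h, rfl, h1, h3, h4⟩))⟩
    · have hi := Shape.step_sup hν hρ
      exact ⟨ν.sup ρ, ⟨hν, hρ, hi.1, hi.2⟩, Or.inl ⟨h, hne⟩⟩

end ColumnRel

/-- Fomin's local rule for the column lengths of diagrams with at most three columns. -/
def columnLocalRule : LocalRule where
  Rel := ColumnRel
  steps h := h.1
  size_of_marked h hx := h.size_of_marked hx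
  size_of_unmarked h hx := h.size_of_unmarked hx
  symm h := h.symm
  exists_backward := ColumnRel.exists_backward
  backward_unique h h' := h.backward_unique h'
  forward_unique h h' := h.forward_unique h'

/-! ### Longest ascents and the column criterion. -/

/-- The number of non-empty columns. -/
def Shape.columns (v : Shape) : ℤ :=
  (if 0 < v.1 then 1 else 0) + (if 0 < v.2.1 then 1 else 0) + if 0 < v.2.2 then 1 else 0

theorem Shape.Step.columns {u v : Shape} (h : u.Step v) :
    u.columns ≤ v.columns ∧ v.columns ≤ u.columns + 1 := by
  simp only [Step, IsPartition, Shape.columns] at *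
  split_ifs <;> omega

theorem Shape.Step.columns_eq {u v : Shape} (h : u.Step v) (hs : v.size = u.size + 1) :
    v.columns = u.columns + if u.boxRow v = 1 then 1 else 0 := by
  simp only [Step, IsPartition, Shape.columns, size, boxRow] at *
  split_ifs at * <;> omega

theorem Shape.columns_sup {u v : Shape} (hu : u.IsPartition) (hv : v.IsPartition) :
    (u.sup v).columns = max u.columns v.columns := by
  simp only [IsPartition, Shape.columns, sup] at *
  split_ifs <;> omega

/-- The number of columns is the length of the first row, which only a box in row one changes;
bumped boxes land lower. So it obeys the first-row rule. -/
theorem ColumnRel.rowRule {μ ν ρ r : Shape} {x : Prop} (h : ColumnRel μ ν ρ x r) :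
    RowRule μ.columns ν.columns ρ.columns x r.columns := by
  obtain ⟨⟨h1, h2, h3, h4⟩, h⟩ := h
  refine ⟨h1.columns.1, h2.columns.1, ?_⟩
  rcases h with ⟨hx, h⟩ | ⟨hx, rfl, rfl, rfl⟩ | ⟨hx, rfl, rfl, h5, h6⟩ | ⟨hx, rfl, h5, h6, h7⟩
  · refine Or.inr ⟨hx, ?_⟩
    rw [Shape.eq_sup_of_steps h1 h2 h3 h4 h, Shape.columns_sup h3.1 h4.1]
  · exact Or.inr ⟨hx, (max_self _).symm⟩
  · refine Or.inl ⟨hx, rfl, rfl, ?_⟩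
    rw [h3.columns_eq h5, if_pos h6]
  · refine Or.inr ⟨hx, ?_⟩
    have := h1.boxRow_pos h5
    rw [h3.columns_eq h6, if_neg (by omega), max_self, add_zero]

/-- There are `k` marks in the rectangle with increasing coordinates. -/
def HasAscent (P Q : ℕ) (x : ℕ → ℕ → Prop) (k : ℕ) : Prop :=
  ∃ a b : ℕ → ℕ, (∀ i < k, a i < P ∧ b i < Q ∧ x (a i) (b i)) ∧
    ∀ i, i + 1 < k → a i < a (i + 1) ∧ b i < b (i + 1)

theorem HasAscent.mono {P Q P' Q' k : ℕ} {x : ℕ → ℕ → Prop} (h : HasAscent P Q x k)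
    (hP : P ≤ P') (hQ : Q ≤ Q') : HasAscent P' Q' x k := by
  obtain ⟨a, b, h1, h2⟩ := h
  exact ⟨a, b, fun i hi => ⟨(h1 i hi).1.trans_le hP, (h1 i hi).2.1.trans_le hQ, (h1 i hi).2.2⟩, h2⟩

theorem HasAscent.succ {P Q k : ℕ} {x : ℕ → ℕ → Prop} (h : HasAscent P Q x k) (hx : x P Q) :
    HasAscent (P + 1) (Q + 1) x (k + 1) := by
  obtain ⟨a, b, h1, h2⟩ := h
  refine ⟨fun i => if i < k then a i else P, fun i => if i < k then b i else Q,
    fun i hi => ?_, fun i hi => ?_⟩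
  · dsimp only
    split_ifs with h
    · have := h1 i h
      exact ⟨by omega, by omega, this.2.2⟩
    · exact ⟨by omega, by omega, hx⟩
  · have hik : i < k := by omega
    simp only [if_pos hik]
    split_ifs with h
    · exact h2 i h
    · have := h1 i hik
      exact ⟨this.1, this.2.1⟩

theorem lt_of_forall_lt_succ {a : ℕ → ℕ} {k : ℕ} (h : ∀ i, i + 1 < k → a i < a (i + 1)) {i j : ℕ}
    (hij : i < j) (hj : j < k) : a i < a j := by
  induction j with
  | zero => omega
  | succ j ih =>
    rcases Nat.lt_succ_iff_lt_or_eq.1 hij with h' | rfl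
    · exact (ih h' (by omega)).trans (h j hj)
    · exact h i hj

theorem IsLayer.le_of_hasAscent {P Q : ℕ} {x : ℕ → ℕ → Prop} {L : ℕ → ℕ → ℤ}
    (h : IsLayer P Q x L) (h0 : 0 ≤ L 0 0) {k : ℕ} (hk : 0 < k) (hd : HasAscent P Q x k) :
    (k : ℤ) ≤ L P Q := by
  induction k generalizing P Q with
  | zero => omega
  | succ k ih =>
    obtain ⟨a, b, h1, h2⟩ := hd
    obtain ⟨ha, hb, hx⟩ := h1 k (by omega)
    have h3 := (h _ ha _ hb).1.2.2.resolve_right fun h' => h'.1 hx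
    have h4 := h.mono (a := a k + 1) (b := b k + 1) ha hb le_rfl le_rfl (by omega) (by omega)
    have h5 : (k : ℤ) ≤ L (a k) (b k) := by
      rcases Nat.eq_zero_or_pos k with rfl | hk0
      · have := h.mono (a := 0) (b := 0) (a' := a 0) (b' := b 0) (by omega) (by omega)
          (by omega) (by omega) (by omega) (by omega)
        push_cast
        omega
      · refine ih (fun a' ha' b' hb' => h a' (by omega) b' (by omega)) hk0
          ⟨a, b, fun i hi => ⟨?_, ?_, (h1 i (by omega)).2.2⟩, fun i hi => h2 i (by omega)⟩
        · exact lt_of_forall_lt_succ (fun i hi => (h2 i hi).1) hi (Nat.lt_succ_self k)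
        · exact lt_of_forall_lt_succ (fun i hi => (h2 i hi).2) hi (Nat.lt_succ_self k)
    push_cast
    omega

/-- The rule for `L` is the recursion for the longest ascent: a mark extends an ascent of the
smaller rectangle, and otherwise one of two subrectangles already contains it. -/
theorem IsLayer.hasAscent_of_le {P Q : ℕ} {x : ℕ → ℕ → Prop} {L : ℕ → ℕ → ℤ}
    (h : IsLayer P Q x L) (hl : ∀ b ≤ Q, L 0 b = 0) (hb : ∀ a ≤ P, L a 0 = 0) {k : ℕ}
    (hk : (k : ℤ) ≤ L P Q) : HasAscent P Q x k := by
  induction P generalizing Q k with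
  | zero =>
    rw [hl Q le_rfl] at hk
    obtain rfl : k = 0 := by omega
    exact ⟨fun _ => 0, fun _ => 0, fun i hi => by omega, fun i hi => by omega⟩
  | succ P ihP =>
    induction Q generalizing k with
    | zero =>
      rw [hb _ le_rfl] at hk
      obtain rfl : k = 0 := by omega
      exact ⟨fun _ => 0, fun _ => 0, fun i hi => by omega, fun i hi => by omega⟩
    | succ Q ihQ =>
      have hP : ∀ Q' ≤ Q + 1, IsLayer P Q' x L := fun Q' hQ' a' ha' b' hb' =>
        h a' (by omega) b' (by omega)
      rcases (h P (by omega) Q (by omega)).1.2.2 with ⟨hx, -, -, h1⟩ | ⟨-, h1⟩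
      · rcases k with _ | k
        · exact ⟨fun _ => 0, fun _ => 0, fun i hi => by omega, fun i hi => by omega⟩
        · refine (ihP (hP Q (by omega)) (fun b hb => hl b (by omega)) (fun a ha => hb a (by omega))
            ?_).succ hx
          push_cast at hk
          omega
      · rw [h1, le_max_iff] at hk
        rcases hk with hk | hk
        · exact (ihQ (fun a' ha' b' hb' => h a' ha' b' (by omega)) (fun b hb => hl b (by omega))
            hk).mono le_rfl (by omega)
        · exact (ihP (hP (Q + 1) le_rfl) (fun b hb => hl b (by omega))
            (fun a ha => hb a (by omega)) hk).mono (by omega) le_rfl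

open Classical in
/-- The forward version of the local rule for columns. -/
noncomputable def columnForward (μ ν ρ : Shape) (x : Prop) : Shape :=
  if h : ∃ r, ColumnRel μ ν ρ x r then h.choose else 0

theorem Shape.columns_zero : Shape.columns 0 = 0 := by
  simp [Shape.columns]

theorem exists_isGrowth_columnLocalRule_iff {N : ℕ} {X : ℕ → ℕ → Prop} (hX : IsPerfect N X) :
    (∃ F, IsGrowth columnLocalRule N X F) ↔ ¬ ∃ P Q, P + Q ≤ N ∧ HasAscent P Q X 4 := by
  have hlayer : ∀ {n : ℕ} {F : ℕ → ℕ → Shape}, IsGrowth columnLocalRule n X F → ∀ P Q, P + Q ≤ n →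
      IsLayer P Q X fun a b => (F a b).columns := by
    intro n F hF P Q hPQ a ha b hb
    have h : ColumnRel _ _ _ _ _ := hF.cell a b (by omega)
    exact ⟨h.rowRule, h.1.1.columns.2, h.1.2.1.columns.2⟩
  constructor
  · rintro ⟨F, hF⟩ ⟨P, Q, hPQ, hd⟩
    have := (hlayer hF P Q hPQ).le_of_hasAscent
      (by rw [hF.left 0 (by omega), Shape.columns_zero]) four_pos hd
    simp only [Shape.columns] at this
    split_ifs at this <;> omega
  · intro hno
    have hl := forwardGrowth_zero_left columnForward X
    have hb := forwardGrowth_zero_right columnForward X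
    have hs : ∀ a b, forwardGrowth columnForward X (a + 1) (b + 1) =
        columnForward (forwardGrowth columnForward X a b)
          (forwardGrowth columnForward X (a + 1) b)
          (forwardGrowth columnForward X a (b + 1)) (X a b) := fun a b => by rw [forwardGrowth]
    refine ⟨forwardGrowth columnForward X, IsGrowth.of_extension hl hb fun n a b hn hab hg => ?_⟩
    set F := forwardGrowth columnForward X
    have hstep := hg.step_right hab.le
    have hx : X a b → F a b = F (a + 1) b ∧ F a b = F a (b + 1) ∧ (F a b).2.2 = 0 := by
      intro hx
      have he := hg.eq_of_marked hX hn hab hx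
      refine ⟨he.1, he.2, ?_⟩
      by_contra h0
      -- Three non-empty columns at `(a, b)` mean three ascending marks before it, and the mark of
      -- this cell is a fourth.
      refine hno ⟨a + 1, b + 1, by omega, HasAscent.succ ?_ hx⟩
      refine (hlayer hg a b (by omega)).hasAscent_of_le
        (fun b _ => by rw [hl b, Shape.columns_zero])
        (fun a _ => by rw [hb a, Shape.columns_zero]) ?_
      have := hstep.1
      simp only [Shape.IsPartition, Shape.columns] at *
      split_ifs <;> omega
    have hex := ColumnRel.exists_forward hstep (hg.step_up hab.le) hx
    have he : F (a + 1) (b + 1) = hex.choose := by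
      rw [hs]
      exact dif_pos hex
    rw [he]
    exact hex.choose_spec

/-! ### Crossings and nestings as chains of marks. -/

section Chains

variable {n : ℕ} {M : Finpartition (Finset.Icc 1 (2 * n))}

theorem IsArc.bounds {i j : ℕ} (h : IsArc M i j) : 1 ≤ i ∧ i < j ∧ j ≤ 2 * n := by
  have hs := M.le h.2
  have hi := hs (show i ∈ ({i, j} : Finset ℕ) by simp)
  have hj := hs (show j ∈ ({i, j} : Finset ℕ) by simp)
  rw [Finset.mem_Icc] at hi hj
  exact ⟨hi.1, h.1, hj.2⟩

theorem IsArc.arcMarks {i j : ℕ} (h : IsArc M i j) : arcMarks M (i - 1) (2 * n - j) := by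
  have hb := h.bounds
  rw [_root_.arcMarks, show i - 1 + 1 = i by omega, show 2 * n - (2 * n - j) = j by omega]
  exact h

theorem hasCrossing_succ_iff (k : ℕ) :
    HasCrossing M (k + 1) ↔ ∃ P Q, P + Q ≤ 2 * n ∧ HasDescent P Q (arcMarks M) (k + 1) := by
  constructor
  · rintro ⟨i, j, hM, hi, hj, hij⟩
    -- The last opener and the first closer bound the rectangle. It fits into the triangle because
    -- every opener precedes every closer.
    refine ⟨i (Fin.last k), 2 * n + 1 - j 0, ?_, fun r => i (Fin.ofNat (k + 1) r) - 1,
      fun r => 2 * n - j (Fin.ofNat (k + 1) r), fun r hr => ⟨?_, ?_, (hM _).arcMarks⟩,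
      fun r hr => ?_⟩
    · have := hij (Fin.last k) 0
      have := (hM 0).bounds
      omega
    · dsimp only
      have h1 := hi.monotone (Fin.le_last (Fin.ofNat (k + 1) r))
      have := (hM (Fin.ofNat (k + 1) r)).bounds
      omega
    · dsimp only
      have h1 := hj.monotone (Fin.zero_le (Fin.ofNat (k + 1) r))
      have := (hM (Fin.ofNat (k + 1) r)).bounds
      omega
    · have hlt : Fin.ofNat (k + 1) r < Fin.ofNat (k + 1) (r + 1) := by
        rw [Fin.lt_def]
        simp only [Fin.ofNat, Nat.mod_eq_of_lt hr, Nat.mod_eq_of_lt (show r < k + 1 by omega)]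
        omega
      have h1 := hi hlt
      have h2 := hj hlt
      have := (hM (Fin.ofNat (k + 1) r)).bounds
      have := (hM (Fin.ofNat (k + 1) (r + 1))).bounds
      exact ⟨by dsimp only; omega, by dsimp only; omega⟩
  · rintro ⟨P, Q, hPQ, a, b, h1, h2⟩
    refine ⟨fun r => a r + 1, fun r => 2 * n - b r, fun r => (h1 r r.2).2.2, ?_, ?_, ?_⟩
    · rw [Fin.strictMono_iff_lt_succ]
      intro r
      have := h2 r (by omega)
      simpa using this.1
    · rw [Fin.strictMono_iff_lt_succ]
      intro r
      have h3 := h2 r (by omega)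
      have h4 := h1 r (by omega)
      simp only [Fin.val_castSucc, Fin.val_succ]
      omega
    · intro r s
      have h3 := h1 r r.2
      have h4 := h1 s s.2
      dsimp only
      omega

theorem hasNesting_succ_iff (k : ℕ) :
    HasNesting M (k + 1) ↔ ∃ P Q, P + Q ≤ 2 * n ∧ HasAscent P Q (arcMarks M) (k + 1) := by
  constructor
  · rintro ⟨i, j, hM, hi, hj, hij⟩
    -- In a nesting the innermost arc has both the last opener and the first closer.
    refine ⟨i (Fin.last k), 2 * n + 1 - j (Fin.last k), ?_, fun r => i (Fin.ofNat (k + 1) r) - 1,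
      fun r => 2 * n - j (Fin.ofNat (k + 1) r), fun r hr => ⟨?_, ?_, (hM _).arcMarks⟩,
      fun r hr => ?_⟩
    · have := (hM (Fin.last k)).bounds
      omega
    · dsimp only
      have h1 := hi.monotone (Fin.le_last (Fin.ofNat (k + 1) r))
      have := (hM (Fin.ofNat (k + 1) r)).bounds
      omega
    · dsimp only
      have h1 := hj.antitone (Fin.le_last (Fin.ofNat (k + 1) r))
      have := (hM (Fin.ofNat (k + 1) r)).bounds
      omega
    · have hlt : Fin.ofNat (k + 1) r < Fin.ofNat (k + 1) (r + 1) := by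
        rw [Fin.lt_def]
        simp only [Fin.ofNat, Nat.mod_eq_of_lt hr, Nat.mod_eq_of_lt (show r < k + 1 by omega)]
        omega
      have h1 := hi hlt
      have h2 := hj hlt
      have := (hM (Fin.ofNat (k + 1) r)).bounds
      have := (hM (Fin.ofNat (k + 1) (r + 1))).bounds
      exact ⟨by dsimp only; omega, by dsimp only; omega⟩
  · rintro ⟨P, Q, hPQ, a, b, h1, h2⟩
    refine ⟨fun r => a r + 1, fun r => 2 * n - b r, fun r => (h1 r r.2).2.2, ?_, ?_, ?_⟩
    · rw [Fin.strictMono_iff_lt_succ]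
      intro r
      have := h2 r (by omega)
      simpa using this.1
    · rw [Fin.strictAnti_iff_succ_lt]
      intro r
      have h3 := h2 r (by omega)
      have h4 := h1 (r + 1) (by omega)
      simp only [Fin.val_castSucc, Fin.val_succ]
      omega
    · intro r s
      have h3 := h1 r r.2
      have h4 := h1 s s.2
      dsimp only
      omega

end Chains

/-! ### Conclusion. -/

theorem bsmNoncrossing_three_eq (m : ℕ) : bsmNoncrossing m 3 = (chamberWalks m 0).card := by
  have h := card_symmetric_matchings_eq_card_walks rowLocalRule m (fun M => ¬ HasCrossing M (3 + 1))
    fun M hM => by rw [hasCrossing_succ_iff, exists_isGrowth_rowLocalRule_iff hM.isPerfect]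
  rw [bsmNoncrossing, ← h]
  congr

theorem bsmNonnesting_three_eq (m : ℕ) : bsmNonnesting m 3 = (chamberWalks m 0).card := by
  have h := card_symmetric_matchings_eq_card_walks columnLocalRule m (fun M => ¬ HasNesting M (3 + 1))
    fun M hM => by rw [hasNesting_succ_iff, exists_isGrowth_columnLocalRule_iff hM.isPerfect]
  rw [bsmNonnesting, ← h]
  congr

theorem mainTheorem8 (n : ℕ) :
    ((bsmNoncrossing (2 * n) 3 : ℚ) =
        ∑ s ∈ Finset.range (n + 1),
          (2 * (Nat.factorial (2 * s + 1) : ℚ)) /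
              ((Nat.factorial s : ℚ) ^ 2 * (Nat.factorial (s + 1) : ℚ) *
                (Nat.factorial (s + 2) : ℚ)) *
            ((Nat.factorial (2 * n) : ℚ) /
              ((Nat.factorial (n - s) : ℚ) * (Nat.factorial (n - s + 1) : ℚ)))) ∧
    ((bsmNoncrossing (2 * n + 1) 3 : ℚ) =
        ∑ s ∈ Finset.range (n + 1),
          (2 * (Nat.factorial (2 * s + 2) : ℚ)) /
              ((Nat.factorial s : ℚ) * (Nat.factorial (s + 1) : ℚ) *
                (Nat.factorial (s + 2) : ℚ) ^ 2) *
            ((Nat.factorial (2 * n + 1) : ℚ) /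
              ((Nat.factorial (n - s) : ℚ) * (Nat.factorial (n - s + 1) : ℚ)))) ∧
    bsmNonnesting (2 * n) 3 = bsmNoncrossing (2 * n) 3 ∧
    bsmNonnesting (2 * n + 1) 3 = bsmNoncrossing (2 * n + 1) 3 := by
  refine ⟨?_, ?_, ?_, ?_⟩
  · rw [bsmNoncrossing_three_eq, card_chamberWalks, egfCoeff_product_even]
  · rw [bsmNoncrossing_three_eq, card_chamberWalks, egfCoeff_product_odd]
  · rw [bsmNonnesting_three_eq, bsmNoncrossing_three_eq]
  · rw [bsmNonnesting_three_eq, bsmNoncrossing_three_eq]
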